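/- **Setting.** Let $m,\ell,g>0$ and $\sigma\ge 0$. For each choice of sign let $P_\pm,\varepsilon_\pm,\delta_\pm\in C^\infty((0,\infty))$ with $P_\pm>0$ strictly increasing, $1/P_\pm'\in L^\infty_{loc}((0,\infty))$, $\varepsilon_\pm>0$ and $\delta_\pm\ge 0$. Put $h_\pm(z)=\int_1^z P_\pm'(r)\,r^{-1}\,dr$ for $z>0$. Let $\rho_0^->0$ satisfy $P_-(\rho_0^-)>P_+(\rho_0^-)$ and $P_-(\rho_0^-)\in P_+((0,\infty))$, put $\rho_0^+=P_+^{-1}(P_-(\rho_0^-))$, and assume $h_-(\rho_0^-)+gm\in h_-((0,\infty))$ and $h_+(\rho_0^+)-g\ell\in h_+((0,\infty))$. The steady density is $$\rho_0(x_3)=h_-^{-1}(h_-(\rho_0^-)-gx_3)\ \ (-m<x_3<0),\qquad \rho_0(x_3)=h_+^{-1}(h_+(\rho_0^+)-gx_3)\ \ (0<x_3<\ell).$$ Write $\varepsilon_0=\varepsilon_\pm(\rho_0)$, $\delta_0=\delta_\pm(\rho_0)$, $P'(\rho_0)=P_\pm'(\rho_0)$, with the sign $-$ on $(-m,0)$ and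 $+$ on $(0,\ell)$; $'=d/dx_3$ for functions of $x_3$; $[\![f]\!]=f(0^+)-f(0^-)$; in particular $[\![\rho_0]\!]=\rho_0^+-\rho_0^->0$. For $\xi\in\mathbb R^2$ and $\lambda>0$ put $A=\lambda\delta_0+\lambda\varepsilon_0/3+P'(\rho_0)\rho_0$ and consider, on $(-m,0)\cup(0,\ell)$, the system for $\varphi,\theta,\psi:[-m,\ell]\to\mathbb R$ $$-(\lambda\varepsilon_0\varphi')'+\left[\lambda^2\rho_0+\lambda\varepsilon_0|\xi|^2+\xi_1^2A\right]\varphi=-\xi_1\left[A\psi'+(\lambda\varepsilon_0'-g\rho_0)\psi\right]-\xi_1\xi_2A\,\theta,$$ $$-(\lambda\varepsilon_0\theta')'+\left[\lambda^2\rho_0+\lambda\varepsilon_0|\xi|^2+\xi_2^2A\right]\theta=-\xi_2\left[A\psi'+(\lambda\varepsilon_0'-g\rho_0)\psi\right]-\xi_1\xi_2A\,\varphi,$$ $$-\left[\left(\tfrac43\lambda\varepsilon_0+\lambda\delta_0+P'(\rho_0)\rho_0\right)\psi'\right]'+(\lambda^2\rho_0+\lambda\varepsilon_0|\xi|^2)\psi=\left[A(\xi_1\varphi+\xi_2\theta)\right]'+(g\rho_0-\lambda\varepsilon_0')(\xi_1\varphi+\xi_2\theta),$$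 with the jump conditions $$[\![\varphi]\!]=[\![\theta]\!]=[\![\psi]\!]=0,\qquad [\![\lambda\varepsilon_0(\varphi'-\xi_1\psi)]\!]=[\![\lambda\varepsilon_0(\theta'-\xi_2\psi)]\!]=0,$$ $$[\![A(\psi'+\xi_1\varphi+\xi_2\theta)]\!]+[\![\lambda\varepsilon_0(\psi'-\xi_1\varphi-\xi_2\theta)]\!]=\sigma|\xi|^2\psi(0)$$ and the boundary conditions $\varphi=\theta=\psi=0$ at $x_3=-m$ and at $x_3=\ell$. **Theorem.** There are a function $\lambda=\lambda(|\xi|)>0$ and functions $\varphi(\xi,x_3),\theta(\xi,x_3),\psi(\xi,x_3)$, defined for all $\xi\in\mathbb R^2$ with $0<|\xi|^2<g[\![\rho_0]\!]/\sigma$ (that is, for all $\xi\ne0$ if $\sigma=0$) and all $x_3\in[-m,\ell]$, such that for each such $\xi$ the functions $\varphi(\xi,\cdot),\theta(\xi,\cdot),\psi(\xi,\cdot)$ are continuous on $[-m,\ell]$, are smooth on $(-m,0)$ and on $(0,\ell)$, solve the system above with $\lambda=\lambda(|\xi|)$ together with its jump and boundary conditions (all the one-sided limits involved exist), and satisfy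 $\psi(\xi,0)\neq0$. Moreover, they are equivariant in $\xi$: for every $R\in SO(2)$, every such $\xi$ and every $x_3\in[-m,\ell]$, $$\begin{pmatrix}\varphi(R\xi,x_3)\\ \theta(R\xi,x_3)\\ \psi(R\xi,x_3)\end{pmatrix}=\begin{pmatrix}R_{11}&R_{12}&0\\R_{21}&R_{22}&0\\0&0&1\end{pmatrix}\begin{pmatrix}\varphi(\xi,x_3)\\ \theta(\xi,x_3)\\ \psi(\xi,x_3)\end{pmatrix}.$$ -/

import Mathlib

open Set Filter Topology
open scoped ContDiff Matrix

noncomputable section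

/-- A pressure law `P`: a positive, strictly increasing smooth function on `(0, ∞)` such that
`1 / P'` is locally bounded on `(0, ∞)`.  As `P'` is continuous and nonnegative on `(0, ∞)`,
local boundedness of `1 / P'` there means that `P'` has no zero, i.e. `P' > 0`. -/
structure IsPressureLaw (P : ℝ → ℝ) : Prop where
  smooth : ContDiffOn ℝ ∞ P (Ioi 0)
  pos : ∀ z, 0 < z → 0 < P z
  strictMono : StrictMonoOn P (Ioi 0)
  deriv_pos : ∀ z, 0 < z → 0 < deriv P z

/-- The enthalpy `h(z) = ∫₁ᶻ P'(r) / r dr` of a pressure law. -/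
def enthalpy (P : ℝ → ℝ) (z : ℝ) : ℝ := ∫ r in (1 : ℝ)..z, deriv P r / r

/-- The physical parameters of two compressible viscous barotropic fluids in the slab
`ℝ² × (-m, ℓ)` together with the densities `ρm`, `ρp` on the two sides of the flat interface
`{x₃ = 0}` in the Rayleigh–Taylor unstable steady state.  The suffix `m` (minus) refers to the
lower fluid, in `(-m, 0)`, and the suffix `p` (plus) to the upper fluid, in `(0, ℓ)`. -/
structure RTParams where
  /-- depth of the lower layer -/
  m : ℝ
  /-- height of the upper layer -/
  ell : ℝ
  /-- gravitational constant -/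
  g : ℝ
  /-- surface tension -/
  σ : ℝ
  /-- pressure laws -/
  Pm : ℝ → ℝ
  Pp : ℝ → ℝ
  /-- shear viscosities, as functions of the density -/
  εm : ℝ → ℝ
  εp : ℝ → ℝ
  /-- bulk viscosities, as functions of the density -/
  δm : ℝ → ℝ
  δp : ℝ → ℝ
  /-- densities at the interface -/
  ρm : ℝ
  ρp : ℝ
  m_pos : 0 < m
  ell_pos : 0 < ell
  g_pos : 0 < g
  σ_nonneg : 0 ≤ σ
  Pm_law : IsPressureLaw Pm
  Pp_law : IsPressureLaw Pp
  εm_smooth : ContDiffOn ℝ ∞ εm (Ioi 0)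
  εp_smooth : ContDiffOn ℝ ∞ εp (Ioi 0)
  δm_smooth : ContDiffOn ℝ ∞ δm (Ioi 0)
  δp_smooth : ContDiffOn ℝ ∞ δp (Ioi 0)
  εm_pos : ∀ z, 0 < z → 0 < εm z
  εp_pos : ∀ z, 0 < z → 0 < εp z
  δm_nonneg : ∀ z, 0 < z → 0 ≤ δm z
  δp_nonneg : ∀ z, 0 < z → 0 ≤ δp z
  ρm_pos : 0 < ρm
  ρp_pos : 0 < ρp
  /-- the pressure is continuous across the interface: `ρp = Pp⁻¹ (Pm ρm)` -/
  pressure_balance : Pp ρp = Pm ρm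
  /-- equivalently `ρm < ρp`: the heavier fluid is on top -/
  unstable : Pp ρm < Pm ρm
  /-- the steady density does not degenerate in the lower layer -/
  lower_range : enthalpy Pm ρm + g * m ∈ enthalpy Pm '' Ioi 0
  /-- the steady density does not degenerate in the upper layer -/
  upper_range : enthalpy Pp ρp - g * ell ∈ enthalpy Pp '' Ioi 0

namespace RTParams

variable (D : RTParams)

/-- The steady density profile `ρ₀(x) = h±⁻¹ (h±(ρ±) - g x)`, where `h±⁻¹` is the inverse of the
enthalpy on `(0, ∞)`.  (The value at `x = 0` plays no role.) -/
def rho0 (x : ℝ) : ℝ :=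
  if x < 0 then Function.invFunOn (enthalpy D.Pm) (Ioi 0) (enthalpy D.Pm D.ρm - D.g * x)
  else Function.invFunOn (enthalpy D.Pp) (Ioi 0) (enthalpy D.Pp D.ρp - D.g * x)

/-- `ε₀ = ε(ρ₀)`. -/
def eps0 (x : ℝ) : ℝ := if x < 0 then D.εm (D.rho0 x) else D.εp (D.rho0 x)

/-- `δ₀ = δ(ρ₀)`. -/
def del0 (x : ℝ) : ℝ := if x < 0 then D.δm (D.rho0 x) else D.δp (D.rho0 x)

/-- `P'(ρ₀) ρ₀`. -/
def pr0 (x : ℝ) : ℝ :=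
  (if x < 0 then deriv D.Pm (D.rho0 x) else deriv D.Pp (D.rho0 x)) * D.rho0 x

/-- The jump `⟦ρ₀⟧ = ρ₀⁺ - ρ₀⁻` of the steady density across the interface. -/
def jumpRho : ℝ := D.ρp - D.ρm

/-- The coefficient `λ δ₀ + λ ε₀ / 3 + P'(ρ₀) ρ₀`. -/
def coefA (lam x : ℝ) : ℝ := lam * D.del0 x + lam * D.eps0 x / 3 + D.pr0 x

end RTParams

/-- `⟦f⟧ = J`: the one-sided limits of `f` at `0` exist, and the limit from above minus the limit
from below is `J`. -/
def HasJump (f : ℝ → ℝ) (J : ℝ) : Prop :=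
  ∃ a b : ℝ, Tendsto f (𝓝[<] 0) (𝓝 a) ∧ Tendsto f (𝓝[>] 0) (𝓝 b) ∧ b - a = J

/-- `f` is smooth on `(-m, 0)` and on `(0, ℓ)`. -/
def RTParams.SmoothOnLayers (D : RTParams) (f : ℝ → ℝ) : Prop :=
  ContDiffOn ℝ ∞ f (Ioo (-D.m) 0) ∧ ContDiffOn ℝ ∞ f (Ioo 0 D.ell)

/-- `(φ, θ, ψ)` solves the normal mode equations with horizontal frequency `ξ` and growth rate
`lam` in both layers, together with the jump conditions at `0` and the boundary conditions at
`-m` and `ℓ`.  (It is used for functions that are smooth on both layers.)  Continuity on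
`[-m, ℓ]` makes the values at `-m` and `ℓ` the traces of the functions there. -/
structure RTParams.IsNormalMode (D : RTParams) (ξ : EuclideanSpace ℝ (Fin 2)) (lam : ℝ)
    (φ θ ψ : ℝ → ℝ) : Prop where
  continuousOn_φ : ContinuousOn φ (Icc (-D.m) D.ell)
  continuousOn_θ : ContinuousOn θ (Icc (-D.m) D.ell)
  continuousOn_ψ : ContinuousOn ψ (Icc (-D.m) D.ell)
  eq1 : ∀ x ∈ Ioo (-D.m) 0 ∪ Ioo 0 D.ell,
    -deriv (fun y => lam * D.eps0 y * deriv φ y) x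
      + (lam ^ 2 * D.rho0 x + lam * D.eps0 x * ‖ξ‖ ^ 2 + ξ 0 ^ 2 * D.coefA lam x) * φ x
    = -ξ 0 * (D.coefA lam x * deriv ψ x + (lam * deriv D.eps0 x - D.g * D.rho0 x) * ψ x)
      - ξ 0 * ξ 1 * D.coefA lam x * θ x
  eq2 : ∀ x ∈ Ioo (-D.m) 0 ∪ Ioo 0 D.ell,
    -deriv (fun y => lam * D.eps0 y * deriv θ y) x
      + (lam ^ 2 * D.rho0 x + lam * D.eps0 x * ‖ξ‖ ^ 2 + ξ 1 ^ 2 * D.coefA lam x) * θ x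
    = -ξ 1 * (D.coefA lam x * deriv ψ x + (lam * deriv D.eps0 x - D.g * D.rho0 x) * ψ x)
      - ξ 0 * ξ 1 * D.coefA lam x * φ x
  eq3 : ∀ x ∈ Ioo (-D.m) 0 ∪ Ioo 0 D.ell,
    -deriv (fun y => (4 * lam * D.eps0 y / 3 + lam * D.del0 y + D.pr0 y) * deriv ψ y) x
      + (lam ^ 2 * D.rho0 x + lam * D.eps0 x * ‖ξ‖ ^ 2) * ψ x
    = deriv (fun y => D.coefA lam y * (ξ 0 * φ y + ξ 1 * θ y)) x
      + (D.g * D.rho0 x - lam * deriv D.eps0 x) * (ξ 0 * φ x + ξ 1 * θ x)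
  jump_φ : HasJump φ 0
  jump_θ : HasJump θ 0
  jump_ψ : HasJump ψ 0
  jump_shear1 : HasJump (fun x => lam * D.eps0 x * (deriv φ x - ξ 0 * ψ x)) 0
  jump_shear2 : HasJump (fun x => lam * D.eps0 x * (deriv θ x - ξ 1 * ψ x)) 0
  jump_normal : ∃ J₁ J₂ : ℝ,
    HasJump (fun x => D.coefA lam x * (deriv ψ x + ξ 0 * φ x + ξ 1 * θ x)) J₁ ∧
    HasJump (fun x => lam * D.eps0 x * (deriv ψ x - ξ 0 * φ x - ξ 1 * θ x)) J₂ ∧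
    J₁ + J₂ = D.σ * ‖ξ‖ ^ 2 * ψ 0
  bdry_φ : φ (-D.m) = 0 ∧ φ D.ell = 0
  bdry_θ : θ (-D.m) = 0 ∧ θ D.ell = 0
  bdry_ψ : ψ (-D.m) = 0 ∧ ψ D.ell = 0

/-- The set of unstable frequencies `0 < |ξ|² < g ⟦ρ₀⟧ / σ`, where the right-hand side is `+∞` in
the absence of surface tension (`σ = 0`). -/
def RTParams.unstableFreq (D : RTParams) : Set (EuclideanSpace ℝ (Fin 2)) :=
  {ξ | 0 < ‖ξ‖ ^ 2 ∧ D.σ * ‖ξ‖ ^ 2 < D.g * D.jumpRho}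

/-- The action of a `2 × 2` matrix on `ℝ²`. -/
def matAct (R : Matrix (Fin 2) (Fin 2) ℝ) (ξ : EuclideanSpace ℝ (Fin 2)) :
    EuclideanSpace ℝ (Fin 2) := WithLp.toLp 2 (R *ᵥ ξ.ofLp)

end

/-! The equations commute with horizontal rotations, so it suffices to treat the frequency `(k, 0)`
with `θ = 0`. If `(F, G)` is such a solution for `k = |ξ|`, then `φ = (ξ₁/|ξ|) F`, `θ = (ξ₂/|ξ|) F`,
`ψ = G` is a mode for `ξ`. As `λ`, `F`, `G` depend on `|ξ|` only, equivariance is automatic. With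
the stresses `α`, `β` as extra unknowns, each layer carries a linear first order system
(`Layer.IsSol`). At the interface `F`, `G`, `α` are continuous and `β` jumps by `σ k² G(0)`.

The growth rate is found by shooting. For `λ = exp t`, prescribe the four wall stresses `p`,
integrate from both walls and let `T t p` be the mismatch at the interface; `T t` is linear in `p`
and continuous in `t`. If some `T t` has a kernel, a kernel vector is a mode. Otherwise solve `T t p
= (0, 0, 0, 1)` for every `t` and follow the interface displacement `s(t) = ψ(0)`, a continuous
function.

The energy flux `α φ + β ψ - g ρ ψ²` has the nonnegative derivative `Layer.density`. Hence a matched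
solution with `ψ(0) = 0` is trivial (`Layer.IsMatched.eq_zero`): kernel vectors have `ψ(0) ≠ 0`, and
`s` has no zero. With unit defect the total energy of both layers is `κ s² - s`, where `κ = g⟦ρ₀⟧ -
σ k² > 0` by the frequency condition. For large `λ` a trace inequality bounds the energy below by `κ
s²`, so `s ≤ 0`. For small `λ` comparison with a displacement without elastic energy bounds it above
by `λ M s² ≤ κ s²`, so `s ≥ 0`. The intermediate value theorem contradicts the absence of zeros. -/

noncomputable section

/-! ### Linear differential equations with continuous dependence on parameters -/

section LinearODE

variable {E : Type*} [NormedAddCommGroup E] [NormedSpace ℝ E] {a b : ℝ}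

/-- The Volterra operator `u ↦ ∫ₐˣ u`. -/
def volterra (hab : a ≤ b) : C(Icc a b, E) →L[ℝ] C(Icc a b, E) :=
  LinearMap.mkContinuous
    { toFun := fun u =>
        ⟨fun x => ∫ t in a..x, IccExtend hab u t,
          (intervalIntegral.continuous_primitive
            (fun _ _ => (u.continuous.Icc_extend' (h := hab)).intervalIntegrable _ _) a).comp
            continuous_subtype_val⟩
      map_add' := fun u v => by
        ext x
        exact intervalIntegral.integral_add
          ((u.continuous.Icc_extend' (h := hab)).intervalIntegrable _ _)
          ((v.continuous.Icc_extend' (h := hab)).intervalIntegrable _ _)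
      map_smul' := fun c u => by
        ext x
        exact intervalIntegral.integral_smul c _ }
    (b - a) (fun u => by
      rw [ContinuousMap.norm_le _ (mul_nonneg (sub_nonneg.2 hab) (norm_nonneg _))]
      intro x
      have h := intervalIntegral.norm_integral_le_of_norm_le_const (a := a) (b := x) (C := ‖u‖)
        (f := IccExtend hab u) (fun t _ => u.norm_coe_le_norm _)
      refine h.trans ?_
      rw [abs_of_nonneg (sub_nonneg.2 x.2.1), mul_comm]
      exact mul_le_mul_of_nonneg_right (sub_le_sub_right x.2.2 _) (norm_nonneg _))

/-- Pointwise application of a continuous family of operators. -/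
def pointwiseApply :
    C(Icc a b, E →L[ℝ] E) →L[ℝ] C(Icc a b, E) →L[ℝ] C(Icc a b, E) :=
  LinearMap.mkContinuous₂
    (LinearMap.mk₂ ℝ
      (fun (A : C(Icc a b, E →L[ℝ] E)) (u : C(Icc a b, E)) =>
        (⟨fun x => A x (u x), A.continuous.clm_apply u.continuous⟩ : C(Icc a b, E)))
      (fun _ _ _ => by ext; simp) (fun _ _ _ => by ext; simp)
      (fun _ _ _ => by ext; simp) (fun _ _ _ => by ext; simp))
    1 (fun A u => by
      rw [ContinuousMap.norm_le _ (by positivity)]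
      intro x
      simp only [LinearMap.mk₂_apply, ContinuousMap.coe_mk, one_mul]
      exact (A x).le_of_opNorm_le_of_le (A.norm_coe_le_norm x) (u.norm_coe_le_norm x))

/-- The integral operator `u ↦ ∫ₐˣ A u` of the linear equation `u' = A u`. -/
def odeOperator (hab : a ≤ b) (A : C(Icc a b, E →L[ℝ] E)) :
    C(Icc a b, E) →L[ℝ] C(Icc a b, E) :=
  (volterra hab).comp (pointwiseApply A)

theorem odeOperator_apply (hab : a ≤ b) (A : C(Icc a b, E →L[ℝ] E)) (u : C(Icc a b, E))
    (x : Icc a b) :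
    odeOperator hab A u x = ∫ t in a..x, A (projIcc a b hab t) (u (projIcc a b hab t)) := rfl

theorem continuous_odeOperator (hab : a ≤ b) :
    Continuous (odeOperator hab : C(Icc a b, E →L[ℝ] E) → _) :=
  continuous_const.clm_comp pointwiseApply.continuous

/-- Each iteration integrates the previous bound once more, which produces the factorial. -/
theorem norm_odeOperator_pow_apply_le (hab : a ≤ b) (A : C(Icc a b, E →L[ℝ] E))
    (u : C(Icc a b, E)) (n : ℕ) (x : Icc a b) :
    ‖(odeOperator hab A ^ n) u x‖ ≤ (‖A‖ * (x - a)) ^ n / n.factorial * ‖u‖ := by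
  induction n generalizing x with
  | zero => simpa using u.norm_coe_le_norm x
  | succ n ih =>
    rw [pow_succ', mul_apply_eq_comp, odeOperator_apply]
    set w := (odeOperator hab A ^ n) u
    have hint : ∀ c : ℝ, ∫ t in a..x, c * (t - a) ^ n = c * ((x - a) ^ (n + 1) / (n + 1)) := by
      intro c
      rw [intervalIntegral.integral_const_mul,
        intervalIntegral.integral_comp_sub_right (fun t => t ^ n) a]
      simp
    have key := intervalIntegral.norm_integral_le_of_norm_le (a := a) (b := x)
      (μ := MeasureTheory.volume)
      (f := fun t => A (projIcc a b hab t) (w (projIcc a b hab t)))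
      (g := fun t => (‖A‖ * (‖A‖ ^ n / n.factorial * ‖u‖)) * (t - a) ^ n) x.2.1
      (Eventually.of_forall fun t ht => by
        have hm : t ∈ Icc a b := ⟨ht.1.le, ht.2.trans x.2.2⟩
        rw [projIcc_of_mem hab hm]
        refine ((A _).le_of_opNorm_le_of_le (A.norm_coe_le_norm _) (ih ⟨t, hm⟩)).trans (le_of_eq ?_)
        simp only [mul_pow]
        ring)
      (by apply Continuous.intervalIntegrable; fun_prop)
    refine key.trans (le_of_eq ?_)
    rw [hint, Nat.factorial_succ, Nat.cast_mul]
    have : (n.factorial : ℝ) ≠ 0 := by positivity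
    push_cast
    rw [mul_pow]
    field_simp
    ring

variable [CompleteSpace E]

/-- Some power `T ^ n` of the integral operator has norm below `1`, and `1 - T` is a factor of the
unit `1 - T ^ n` that commutes with its cofactor. No smallness of `A` or of the interval is needed.
-/
theorem isUnit_one_sub_odeOperator (hab : a ≤ b) (A : C(Icc a b, E →L[ℝ] E)) :
    IsUnit (1 - odeOperator hab A) := by
  have hlim := FloorSemiring.tendsto_pow_div_factorial_atTop (‖A‖ * (b - a))
  obtain ⟨n, hn⟩ := (hlim.eventually (gt_mem_nhds one_pos)).exists
  have hn0 : 0 ≤ (‖A‖ * (b - a)) ^ n / n.factorial := by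
    have := sub_nonneg.2 hab
    positivity
  have hnorm : ‖odeOperator hab A ^ n‖ < 1 := by
    refine lt_of_le_of_lt (ContinuousLinearMap.opNorm_le_bound _ hn0 fun u => ?_) hn
    rw [ContinuousMap.norm_le _ (by positivity)]
    intro x
    refine (norm_odeOperator_pow_apply_le hab A u n x).trans ?_
    have := sub_nonneg.2 x.2.1
    have := x.2.2
    gcongr
  have hu : IsUnit (1 - odeOperator hab A ^ n) := 
    isUnit_one_sub_of_norm_lt_one (R := C(Icc a b, E) →L[ℝ] C(Icc a b, E)) hnorm
  rw [← mul_neg_geom_sum] at hu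
  exact (Commute.isUnit_mul_iff ((Commute.one_left _).sub_left
    (Commute.sum_right _ _ _ fun i _ => Commute.self_pow _ i))).1 hu |>.1

/-- Solutions of a linear equation `y' = A y` on `[a, b]` exist for all initial values at `a`, and
the value at `b` depends continuously on parameters. -/
theorem exists_linear_flow {Λ : Type*} [TopologicalSpace Λ] (hab : a ≤ b)
    (A : Λ → ℝ → E →L[ℝ] E) (hA : Continuous fun p : Λ × Icc a b => A p.1 p.2) :
    ∃ Φ : Λ → E →L[ℝ] E, Continuous Φ ∧ ∀ s v, ∃ y : ℝ → E, y a = v ∧ y b = Φ s v ∧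
      ∀ x ∈ Icc a b, HasDerivAt y (A s x (y x)) x := by
  let Ac : C(Λ, C(Icc a b, E →L[ℝ] E)) := ContinuousMap.curry ⟨_, hA⟩
  let S : Λ → C(Icc a b, E) →L[ℝ] C(Icc a b, E) := fun s =>
    Ring.inverse (1 - odeOperator hab (Ac s))
  -- Inversion is continuous at units, so the resolvent inherits continuity in the parameter.
  have hS : Continuous S := by
    rw [continuous_iff_continuousAt]
    intro s
    obtain ⟨U, hU⟩ := isUnit_one_sub_odeOperator hab (Ac s)
    have h1 := NormedRing.inverse_continuousAt (R := C(Icc a b, E) →L[ℝ] C(Icc a b, E)) U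
    rw [hU] at h1
    exact ContinuousAt.comp (f := fun s => 1 - odeOperator hab (Ac s)) h1
      (continuous_const.sub ((continuous_odeOperator hab).comp Ac.continuous)).continuousAt
  let κ : E →L[ℝ] C(Icc a b, E) := LinearMap.mkContinuous
    { toFun := fun v => ContinuousMap.const _ v
      map_add' := fun _ _ => rfl
      map_smul' := fun _ _ => rfl } 1 (fun v => by
        rw [ContinuousMap.norm_le _ (by positivity)]
        intro x
        exact (one_mul ‖v‖).ge)
  let eb : C(Icc a b, E) →L[ℝ] E := ContinuousMap.evalCLM ℝ ⟨b, right_mem_Icc.2 hab⟩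
  refine ⟨fun s => eb.comp ((S s).comp κ),
    continuous_const.clm_comp (hS.clm_comp continuous_const), fun s v => ?_⟩
  set u : C(Icc a b, E) := S s (κ v) with hu
  have hfix : u = κ v + odeOperator hab (Ac s) u := by
    have h1 : (1 - odeOperator hab (Ac s)) * S s = 1 :=
      Ring.mul_inverse_cancel _ (isUnit_one_sub_odeOperator hab (Ac s))
    have h2 := congrArg (fun T => T (κ v)) h1
    simp only [mul_apply_eq_comp, sub_apply,
      one_apply_eq_self] at h2
    rw [← hu] at h2
    rw [← h2]
    abel
  have hcont : Continuous fun t => Ac s (projIcc a b hab t) (u (projIcc a b hab t)) :=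
    ((Ac s).continuous.comp continuous_projIcc).clm_apply (u.continuous.comp continuous_projIcc)
  have hy : ∀ x (hx : x ∈ Icc a b),
      v + ∫ t in a..x, Ac s (projIcc a b hab t) (u (projIcc a b hab t)) = u ⟨x, hx⟩ := by
    intro x hx
    conv_rhs => rw [hfix]
    rfl
  -- The integrand is extended continuously beyond `[a, b]` by projection, so the derivative is
  -- two-sided even at the end points.
  refine ⟨fun x => v + ∫ t in a..x, Ac s (projIcc a b hab t) (u (projIcc a b hab t)),
    by simp, hy b (right_mem_Icc.2 hab), fun x hx => ?_⟩
  beta_reduce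
  rw [hy x hx]
  have h := (hcont.integral_hasStrictDerivAt a x).hasDerivAt.const_add v
  rw [projIcc_of_mem hab hx] at h
  exact h

/-- The version of `exists_linear_flow` with initial values at the right end point. -/
theorem exists_linear_flow_left {Λ : Type*} [TopologicalSpace Λ] (hab : a ≤ b)
    (A : Λ → ℝ → E →L[ℝ] E) (hA : Continuous fun p : Λ × Icc a b => A p.1 p.2) :
    ∃ Φ : Λ → E →L[ℝ] E, Continuous Φ ∧ ∀ s v, ∃ y : ℝ → E, y b = v ∧ y a = Φ s v ∧
      ∀ x ∈ Icc a b, HasDerivAt y (A s x (y x)) x := by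
  have hmem : ∀ x ∈ Icc (-b) (-a), -x ∈ Icc a b := fun x hx =>
    ⟨by linarith [hx.2], by linarith [hx.1]⟩
  obtain ⟨Φ, hΦ, h⟩ := exists_linear_flow (neg_le_neg hab) (fun s x => -A s (-x)) (by
    have := hA.comp (f := fun p : Λ × Icc (-b) (-a) =>
      ((p.1, ⟨-p.2, hmem _ p.2.2⟩) : Λ × Icc a b)) (by fun_prop)
    exact this.neg)
  refine ⟨Φ, hΦ, fun s v => ?_⟩
  obtain ⟨y, hy1, hy2, hy3⟩ := h s v
  refine ⟨fun x => y (-x), hy1, hy2, fun x hx => ?_⟩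
  have h1 := hy3 (-x) ⟨by linarith [hx.2], by linarith [hx.1]⟩
  have h2 := h1.scomp x (hasDerivAt_neg x)
  simpa [Function.comp_def] using h2

end LinearODE

/-! ### One fluid layer: first order system and energy identities -/

/-- The coefficients of the normal mode equations in one fluid layer `[a, b]`: density `ρ`, shear
viscosity `ε`, bulk viscosity `δ` and `π = P'(ρ) ρ`, subject to the hydrostatic balance
`P'(ρ) ρ' = -g ρ`. -/
structure Layer where
  a : ℝ
  b : ℝ
  g : ℝ
  ρ : ℝ → ℝ
  ε : ℝ → ℝ
  δ : ℝ → ℝ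
  π : ℝ → ℝ
  a_lt_b : a < b
  ρ_smooth : ∀ x ∈ Icc a b, ContDiffAt ℝ ∞ ρ x
  ε_smooth : ∀ x ∈ Icc a b, ContDiffAt ℝ ∞ ε x
  δ_smooth : ∀ x ∈ Icc a b, ContDiffAt ℝ ∞ δ x
  π_smooth : ∀ x ∈ Icc a b, ContDiffAt ℝ ∞ π x
  ρ_pos : ∀ x ∈ Icc a b, 0 < ρ x
  ε_pos : ∀ x ∈ Icc a b, 0 < ε x
  δ_nonneg : ∀ x ∈ Icc a b, 0 ≤ δ x
  π_pos : ∀ x ∈ Icc a b, 0 < π x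
  hydrostatic : ∀ x ∈ Icc a b, HasDerivAt ρ (-(g * ρ x ^ 2 / π x)) x

namespace Layer

variable (K : Layer) {k lam : ℝ} {φ ψ α β : ℝ → ℝ} {x : ℝ}

/-- The coefficient `λ δ + λ ε / 3 + π`. -/
def A (lam x : ℝ) : ℝ := lam * K.δ x + lam * K.ε x / 3 + K.π x

/-- `φ'` in terms of the unknowns and the shear stress `α`. -/
def dφ (k lam x ψ α : ℝ) : ℝ := k * ψ + α / (lam * K.ε x)

/-- `ψ'` in terms of the unknowns and the normal stress `β`. -/
def dψ (k lam x φ β : ℝ) : ℝ :=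
  (β - k * (K.A lam x - lam * K.ε x) * φ) / (K.A lam x + lam * K.ε x)

/-- The normal mode equations for the frequency `(k, 0)` with `θ = 0`, written as a first order
system for `φ`, `ψ` and the stresses `α = λ ε (φ' - k ψ)` and
`β = A (ψ' + k φ) + λ ε (ψ' - k φ)`. -/
structure IsSol (k lam : ℝ) (φ ψ α β : ℝ → ℝ) : Prop where
  hφ : ∀ x ∈ Icc K.a K.b, HasDerivAt φ (K.dφ k lam x (ψ x) (α x)) x
  hψ : ∀ x ∈ Icc K.a K.b, HasDerivAt ψ (K.dψ k lam x (φ x) (β x)) x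
  hα : ∀ x ∈ Icc K.a K.b, HasDerivAt α (lam ^ 2 * K.ρ x * φ x
    + k * (K.A lam x - lam * K.ε x) * K.dψ k lam x (φ x) (β x)
    + k ^ 2 * (K.A lam x + lam * K.ε x) * φ x - k * K.g * K.ρ x * ψ x) x
  hβ : ∀ x ∈ Icc K.a K.b, HasDerivAt β
    (lam ^ 2 * K.ρ x * ψ x - k * α x - k * K.g * K.ρ x * φ x) x

/-- The dissipation and elastic energy density of the displacement `(φ, ψ)` with derivatives
`(p, q)`. -/
def density (k lam x φ ψ p q : ℝ) : ℝ :=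
  lam ^ 2 * K.ρ x * (φ ^ 2 + ψ ^ 2) + lam * K.ε x * (p - k * ψ) ^ 2
    + lam * K.ε x * (q - k * φ) ^ 2 + lam * (K.δ x + K.ε x / 3) * (q + k * φ) ^ 2
    + K.π x * (q + k * φ - K.g * K.ρ x * ψ / K.π x) ^ 2

variable {K}

theorem A_pos (hl : 0 < lam) (hx : x ∈ Icc K.a K.b) : 0 < K.A lam x := by
  have h1 := K.ε_pos x hx
  have h2 := K.δ_nonneg x hx
  have h3 := K.π_pos x hx
  unfold A
  positivity

theorem density_nonneg (hl : 0 < lam) (hx : x ∈ Icc K.a K.b) (φ ψ p q : ℝ) :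
    0 ≤ K.density k lam x φ ψ p q := by
  have h0 := K.ρ_pos x hx
  have h1 := K.ε_pos x hx
  have h2 := K.δ_nonneg x hx
  have h3 := K.π_pos x hx
  unfold density
  positivity

theorem mul_dφ (hl : 0 < lam) (hx : x ∈ Icc K.a K.b) (ψ α : ℝ) :
    lam * K.ε x * (K.dφ k lam x ψ α - k * ψ) = α := by
  have h1 := K.ε_pos x hx
  unfold dφ
  field_simp
  ring

theorem mul_dψ (hl : 0 < lam) (hx : x ∈ Icc K.a K.b) (φ β : ℝ) :
    (K.A lam x + lam * K.ε x) * K.dψ k lam x φ β = β - k * (K.A lam x - lam * K.ε x) * φ := by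
  have h1 := K.ε_pos x hx
  have h2 := A_pos hl hx
  unfold dψ
  field_simp

namespace IsSol

/-- The energy identity for a solution tested with an arbitrary displacement `(φ₁, ψ₁)`: the
comparison function below has derivative
`density (φ₁, ψ₁) - density (φ₁ - φ, ψ₁ - ψ)`. -/
theorem hasDerivAt_comparison (h : K.IsSol k lam φ ψ α β) (hl : 0 < lam) (hx : x ∈ Icc K.a K.b)
    {φ₁ ψ₁ : ℝ → ℝ} {p q : ℝ} (hp : HasDerivAt φ₁ p x) (hq : HasDerivAt ψ₁ q x) :
    HasDerivAt (fun y => 2 * (α y * φ₁ y + β y * ψ₁ y) - (α y * φ y + β y * ψ y)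
        + K.g * K.ρ y * (ψ₁ y - ψ y) ^ 2 - K.g * K.ρ y * ψ₁ y ^ 2)
      (K.density k lam x (φ₁ x) (ψ₁ x) p q
        - K.density k lam x (φ₁ x - φ x) (ψ₁ x - ψ x) (p - K.dφ k lam x (ψ x) (α x))
          (q - K.dψ k lam x (φ x) (β x))) x := by
  have e1 := h.hφ x hx
  have e2 := h.hψ x hx
  have e3 := h.hα x hx
  have e4 := h.hβ x hx
  have e5 := K.hydrostatic x hx
  have hπ := (K.π_pos x hx).ne'
  have m1 := mul_dφ (k := k) hl hx (ψ x) (α x)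
  have m2 := mul_dψ (k := k) hl hx (φ x) (β x)
  have H := (((((e3.mul hp).add (e4.mul hq)).const_mul 2).sub ((e3.mul e1).add (e4.mul e2))).add
    ((e5.const_mul K.g).mul ((hq.sub e2).pow 2))).sub ((e5.const_mul K.g).mul (hq.pow 2))
  refine H.congr_deriv ?_
  have hA : K.A lam x = lam * K.δ x + lam * K.ε x / 3 + K.π x := rfl
  generalize K.dφ k lam x (ψ x) (α x) = p' at *
  generalize K.dψ k lam x (φ x) (β x) = q' at *
  have m2' : β x = (K.A lam x + lam * K.ε x) * q' + k * (K.A lam x - lam * K.ε x) * φ x := by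
    linarith
  unfold density
  simp only [Pi.sub_apply, Pi.pow_apply]
  rw [m2', ← m1, hA]
  field_simp
  ring

theorem hasDerivAt_energy (h : K.IsSol k lam φ ψ α β) (hl : 0 < lam) (hx : x ∈ Icc K.a K.b) :
    HasDerivAt (fun y => α y * φ y + β y * ψ y - K.g * K.ρ y * ψ y ^ 2)
      (K.density k lam x (φ x) (ψ x) (K.dφ k lam x (ψ x) (α x)) (K.dψ k lam x (φ x) (β x))) x := by
  have H := h.hasDerivAt_comparison hl hx (h.hφ x hx) (h.hψ x hx)
  have h0 : K.density k lam x 0 0 0 0 = 0 := by simp [density]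
  simp only [sub_self, h0, sub_zero] at H
  refine H.congr_of_eventuallyEq (Eventually.of_forall fun y => ?_)
  ring

theorem monotoneOn_energy (h : K.IsSol k lam φ ψ α β) (hl : 0 < lam) :
    MonotoneOn (fun y => α y * φ y + β y * ψ y - K.g * K.ρ y * ψ y ^ 2) (Icc K.a K.b) := by
  refine monotoneOn_of_hasDerivWithinAt_nonneg (convex_Icc _ _)
    (fun x hx => (h.hasDerivAt_energy hl hx).continuousAt.continuousWithinAt)
    (fun x hx => (h.hasDerivAt_energy hl (interior_subset hx)).hasDerivWithinAt)
    (fun x hx => density_nonneg hl (interior_subset hx) _ _ _ _)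

/-- If the energy flux through both ends of the layer is the same, the solution is trivial. -/
theorem eq_zero_of_energy_eq (h : K.IsSol k lam φ ψ α β) (hl : 0 < lam)
    (hE : α K.b * φ K.b + β K.b * ψ K.b - K.g * K.ρ K.b * ψ K.b ^ 2 ≤
      α K.a * φ K.a + β K.a * ψ K.a - K.g * K.ρ K.a * ψ K.a ^ 2) :
    ∀ x ∈ Icc K.a K.b, φ x = 0 ∧ ψ x = 0 ∧ α x = 0 ∧ β x = 0 := by
  have hmono := h.monotoneOn_energy hl
  have hab := K.a_lt_b
  have hint : ∀ x ∈ Ioo K.a K.b, φ x = 0 ∧ ψ x = 0 := by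
    intro x hx
    have hx' := Ioo_subset_Icc_self hx
    have hd := h.hasDerivAt_energy hl hx'
    -- The flux is monotone and its end values are in the reverse order, so it is constant and the
    -- density vanishes.
    have hc : (fun y => α y * φ y + β y * ψ y - K.g * K.ρ y * ψ y ^ 2) =ᶠ[𝓝 x]
        fun _ => α K.a * φ K.a + β K.a * ψ K.a - K.g * K.ρ K.a * ψ K.a ^ 2 := by
      filter_upwards [isOpen_Ioo.mem_nhds hx] with y hy
      have hy' := Ioo_subset_Icc_self hy
      have h1 := hmono (left_mem_Icc.2 hab.le) hy' hy.1.le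
      have h2 := hmono hy' (right_mem_Icc.2 hab.le) hy.2.le
      simp only at h1 h2
      linarith
    have h0 := hd.unique ((hasDerivAt_const x _).congr_of_eventuallyEq hc)
    have hρ := K.ρ_pos x hx'
    have h1 := K.ε_pos x hx'
    have h2 := K.δ_nonneg x hx'
    have h3 := K.π_pos x hx'
    have hle : lam ^ 2 * K.ρ x * (φ x ^ 2 + ψ x ^ 2) ≤ 0 := by
      rw [← h0]
      unfold density
      rw [add_assoc, add_assoc, add_assoc]
      apply le_add_of_nonneg_right
      positivity
    have hs : φ x ^ 2 + ψ x ^ 2 ≤ 0 := by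
      by_contra! hcon
      have : 0 < lam ^ 2 * K.ρ x * (φ x ^ 2 + ψ x ^ 2) := by positivity
      linarith
    constructor <;> nlinarith [sq_nonneg (φ x), sq_nonneg (ψ x)]
  -- Where `φ` and `ψ` vanish identically so do their derivatives, and these determine the stresses.
  have hint2 : ∀ x ∈ Ioo K.a K.b, α x = 0 ∧ β x = 0 := by
    intro x hx
    have hx' := Ioo_subset_Icc_self hx
    have e1 : K.dφ k lam x (ψ x) (α x) = 0 := by
      refine (h.hφ x hx').unique ((hasDerivAt_const x 0).congr_of_eventuallyEq ?_)
      filter_upwards [isOpen_Ioo.mem_nhds hx] with y hy using (hint y hy).1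
    have e2 : K.dψ k lam x (φ x) (β x) = 0 := by
      refine (h.hψ x hx').unique ((hasDerivAt_const x 0).congr_of_eventuallyEq ?_)
      filter_upwards [isOpen_Ioo.mem_nhds hx] with y hy using (hint y hy).2
    have m1 := mul_dφ (k := k) hl hx' (ψ x) (α x)
    have m2 := mul_dψ (k := k) hl hx' (φ x) (β x)
    rw [e1, (hint x hx).2] at m1
    rw [e2, (hint x hx).1] at m2
    constructor <;> linarith
  have ext : ∀ f : ℝ → ℝ, (∀ x ∈ Icc K.a K.b, ContinuousAt f x) → (∀ x ∈ Ioo K.a K.b, f x = 0) →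
      ∀ x ∈ Icc K.a K.b, f x = 0 := by
    intro f hf hf0
    have hcl := closure_Ioo hab.ne
    exact EqOn.of_subset_closure (g := fun _ => 0) hf0
      (fun x hx => (hf x hx).continuousWithinAt) continuousOn_const Ioo_subset_Icc_self hcl.ge
  intro x hx
  exact ⟨ext φ (fun y hy => (h.hφ y hy).continuousAt) (fun y hy => (hint y hy).1) x hx,
    ext ψ (fun y hy => (h.hψ y hy).continuousAt) (fun y hy => (hint y hy).2) x hx,
    ext α (fun y hy => (h.hα y hy).continuousAt) (fun y hy => (hint2 y hy).1) x hx,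
    ext β (fun y hy => (h.hβ y hy).continuousAt) (fun y hy => (hint2 y hy).2) x hx⟩

end IsSol

end Layer

/-! ### Energy bounds for large and small growth rates, and regularity -/

namespace Layer

variable {K : Layer} {k lam : ℝ} {φ ψ α β : ℝ → ℝ} {x : ℝ}

theorem contDiffAt_A (hx : x ∈ Icc K.a K.b) : ContDiffAt ℝ ∞ (K.A lam) x := by
  unfold A
  have h1 := K.ε_smooth x hx
  have h2 := K.δ_smooth x hx
  have h3 := K.π_smooth x hx
  fun_prop

namespace IsSol

/-- For large growth rates the energy flux controls the displacement of the interface. -/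
theorem monotoneOn_energy_sub {κ : ℝ} (K : Layer) (hk : 0 ≤ k) (hκ : 0 ≤ κ) :
    ∃ Λ : ℝ, 0 < Λ ∧ ∀ lam, Λ ≤ lam → ∀ φ ψ α β, K.IsSol k lam φ ψ α β →
      MonotoneOn (fun y => α y * φ y + β y * ψ y - K.g * K.ρ y * ψ y ^ 2 - κ * ψ y ^ 2)
        (Icc K.a K.b) := by
  have hne : (Icc K.a K.b).Nonempty := nonempty_Icc.2 K.a_lt_b.le
  obtain ⟨x₁, hx₁, h₁⟩ := isCompact_Icc.exists_isMinOn hne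
    (fun x hx => (K.ρ_smooth x hx).continuousAt.continuousWithinAt)
  obtain ⟨x₂, hx₂, h₂⟩ := isCompact_Icc.exists_isMinOn hne
    (fun x hx => (K.ε_smooth x hx).continuousAt.continuousWithinAt)
  have hr := K.ρ_pos x₁ hx₁
  have he := K.ε_pos x₂ hx₂
  set r := K.ρ x₁
  set e := K.ε x₂
  -- The quotient is what Young's inequality needs to absorb `(κ ψ²)' = 2κψ(ψ' - kφ) + 2κkφψ`; the
  -- summand `1` ensures `λ² ≥ λ` and `λ ε ≥ e`.
  refine ⟨1 + (κ ^ 2 / e + κ * k) / r, by positivity, fun lam hlam φ ψ α β h => ?_⟩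
  have h1lam : 1 ≤ lam := le_trans (by
    have : 0 ≤ (κ ^ 2 / e + κ * k) / r := by positivity
    linarith) hlam
  have hl : 0 < lam := by linarith
  have hbig : κ ^ 2 / e + κ * k ≤ lam * r := by
    have : (κ ^ 2 / e + κ * k) / r ≤ lam := by linarith
    rwa [div_le_iff₀ hr] at this
  have hd : ∀ x ∈ Icc K.a K.b, HasDerivAt
      (fun y => α y * φ y + β y * ψ y - K.g * K.ρ y * ψ y ^ 2 - κ * ψ y ^ 2)
      (K.density k lam x (φ x) (ψ x) (K.dφ k lam x (ψ x) (α x)) (K.dψ k lam x (φ x) (β x))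
        - κ * (2 * ψ x * K.dψ k lam x (φ x) (β x))) x := fun x hx => by
    refine ((h.hasDerivAt_energy hl hx).sub (((h.hψ x hx).pow 2).const_mul κ)).congr_deriv ?_
    simp
  refine monotoneOn_of_hasDerivWithinAt_nonneg (convex_Icc _ _)
    (fun x hx => (hd x hx).continuousAt.continuousWithinAt)
    (fun x hx => (hd x (interior_subset hx)).hasDerivWithinAt) (fun x hx => ?_)
  replace hx := interior_subset hx
  generalize K.dψ k lam x (φ x) (β x) = q
  generalize K.dφ k lam x (ψ x) (α x) = p
  have hρ : r ≤ K.ρ x := h₁ hx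
  have hε : e ≤ K.ε x := h₂ hx
  have hδ := K.δ_nonneg x hx
  have hπ := K.π_pos x hx
  have hε0 := K.ε_pos x hx
  have hρ0 := K.ρ_pos x hx
  have hD : lam * r * (φ x ^ 2 + ψ x ^ 2) + e * (q - k * φ x) ^ 2 ≤
      K.density k lam x (φ x) (ψ x) p q := by
    have a1 : lam * r * (φ x ^ 2 + ψ x ^ 2) ≤ lam ^ 2 * K.ρ x * (φ x ^ 2 + ψ x ^ 2) := by
      have : lam ≤ lam ^ 2 := by nlinarith
      gcongr
    have a2 : e * (q - k * φ x) ^ 2 ≤ lam * K.ε x * (q - k * φ x) ^ 2 := by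
      have : e ≤ lam * K.ε x := by nlinarith
      gcongr
    have a3 : 0 ≤ lam * K.ε x * (p - k * ψ x) ^ 2 := by positivity
    have a4 : 0 ≤ lam * (K.δ x + K.ε x / 3) * (q + k * φ x) ^ 2 := by positivity
    have a5 : 0 ≤ K.π x * (q + k * φ x - K.g * K.ρ x * ψ x / K.π x) ^ 2 := by positivity
    unfold density
    linarith
  have h3 : (κ ^ 2 / e + κ * k) * (φ x ^ 2 + ψ x ^ 2) ≤ lam * r * (φ x ^ 2 + ψ x ^ 2) := by
    gcongr
  -- Young's inequality for `2κψ(q - kφ)` as a completed square; `h7` does the same for `2κkφψ`.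
  have h4 : 0 ≤ e * (q - k * φ x - κ * ψ x / e) ^ 2 := by positivity
  have h5 : e * (q - k * φ x - κ * ψ x / e) ^ 2 =
      e * (q - k * φ x) ^ 2 - 2 * κ * ψ x * (q - k * φ x) + κ ^ 2 / e * ψ x ^ 2 := by
    field_simp
    ring
  have h6 : 0 ≤ κ ^ 2 / e * φ x ^ 2 := by positivity
  have h7 : 0 ≤ κ * k * (φ x - ψ x) ^ 2 := by positivity
  nlinarith

/-- Comparison of a solution with a displacement of energy density at most `M`. -/
theorem comparison_le (h : K.IsSol k lam φ ψ α β) (hl : 0 < lam) {φ₁ ψ₁ p q : ℝ → ℝ} {M : ℝ}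
    (hp : ∀ x ∈ Icc K.a K.b, HasDerivAt φ₁ (p x) x)
    (hq : ∀ x ∈ Icc K.a K.b, HasDerivAt ψ₁ (q x) x)
    (hM : ∀ x ∈ Icc K.a K.b, K.density k lam x (φ₁ x) (ψ₁ x) (p x) (q x) ≤ M) :
    (2 * (α K.b * φ₁ K.b + β K.b * ψ₁ K.b) - (α K.b * φ K.b + β K.b * ψ K.b)
        + K.g * K.ρ K.b * (ψ₁ K.b - ψ K.b) ^ 2 - K.g * K.ρ K.b * ψ₁ K.b ^ 2)
      - (2 * (α K.a * φ₁ K.a + β K.a * ψ₁ K.a) - (α K.a * φ K.a + β K.a * ψ K.a)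
        + K.g * K.ρ K.a * (ψ₁ K.a - ψ K.a) ^ 2 - K.g * K.ρ K.a * ψ₁ K.a ^ 2)
      ≤ M * (K.b - K.a) := by
  have hd := fun x hx => h.hasDerivAt_comparison hl hx (hp x hx) (hq x hx)
  refine (convex_Icc K.a K.b).image_sub_le_mul_sub_of_deriv_le
    (f := fun y => 2 * (α y * φ₁ y + β y * ψ₁ y) - (α y * φ y + β y * ψ y)
        + K.g * K.ρ y * (ψ₁ y - ψ y) ^ 2 - K.g * K.ρ y * ψ₁ y ^ 2)
    (fun x hx => (hd x hx).continuousAt.continuousWithinAt)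
    (fun x hx => (hd x (interior_subset hx)).differentiableAt.differentiableWithinAt)
    (fun x hx => ?_) _ (left_mem_Icc.2 K.a_lt_b.le) _ (right_mem_Icc.2 K.a_lt_b.le) K.a_lt_b.le
  rw [(hd x (interior_subset hx)).deriv]
  have h1 := hM x (interior_subset hx)
  have h2 := density_nonneg (k := k) hl (interior_subset hx) (φ₁ x - φ x) (ψ₁ x - ψ x)
    (p x - K.dφ k lam x (ψ x) (α x)) (q x - K.dψ k lam x (φ x) (β x))
  linarith

/-- Bootstrapping: the right-hand sides are as smooth as the unknowns, so each pass gains one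
derivative. -/
theorem contDiffOn (h : K.IsSol k lam φ ψ α β) (hl : 0 < lam) :
    ContDiffOn ℝ ∞ φ (Ioo K.a K.b) ∧ ContDiffOn ℝ ∞ ψ (Ioo K.a K.b) ∧
      ContDiffOn ℝ ∞ α (Ioo K.a K.b) ∧ ContDiffOn ℝ ∞ β (Ioo K.a K.b) := by
  have hsub : Ioo K.a K.b ⊆ Icc K.a K.b := Ioo_subset_Icc_self
  suffices H : ∀ n : ℕ, ContDiffOn ℝ n φ (Ioo K.a K.b) ∧ ContDiffOn ℝ n ψ (Ioo K.a K.b) ∧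
      ContDiffOn ℝ n α (Ioo K.a K.b) ∧ ContDiffOn ℝ n β (Ioo K.a K.b) by
    simp only [contDiffOn_infty]
    exact ⟨fun n => (H n).1, fun n => (H n).2.1, fun n => (H n).2.2.1, fun n => (H n).2.2.2⟩
  intro n
  induction n with
  | zero =>
    simp only [Nat.cast_zero, contDiffOn_zero]
    exact ⟨fun x hx => (h.hφ x (hsub hx)).continuousAt.continuousWithinAt,
      fun x hx => (h.hψ x (hsub hx)).continuousAt.continuousWithinAt,
      fun x hx => (h.hα x (hsub hx)).continuousAt.continuousWithinAt,
      fun x hx => (h.hβ x (hsub hx)).continuousAt.continuousWithinAt⟩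
  | succ n ih =>
    obtain ⟨i1, i2, i3, i4⟩ := ih
    have step : ∀ f f' : ℝ → ℝ, (∀ x ∈ Icc K.a K.b, HasDerivAt f (f' x) x) →
        ContDiffOn ℝ n f' (Ioo K.a K.b) → ContDiffOn ℝ (n + 1 : ℕ) f (Ioo K.a K.b) := by
      intro f f' hf hf'
      push_cast
      rw [contDiffOn_succ_iff_deriv_of_isOpen isOpen_Ioo]
      refine ⟨fun x hx => (hf x (hsub hx)).differentiableAt.differentiableWithinAt,
        fun hn => absurd hn (by simp), hf'.congr fun x hx => (hf x (hsub hx)).deriv⟩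
    have cρ : ContDiffOn ℝ n K.ρ (Ioo K.a K.b) := fun x hx =>
      ((K.ρ_smooth x (hsub hx)).of_le (mod_cast le_top)).contDiffWithinAt
    have cε : ContDiffOn ℝ n K.ε (Ioo K.a K.b) := fun x hx =>
      ((K.ε_smooth x (hsub hx)).of_le (mod_cast le_top)).contDiffWithinAt
    have cA : ContDiffOn ℝ n (K.A lam) (Ioo K.a K.b) := fun x hx =>
      ((contDiffAt_A (hsub hx)).of_le (mod_cast le_top)).contDiffWithinAt
    have n1 : ∀ x ∈ Ioo K.a K.b, lam * K.ε x ≠ 0 := fun x hx =>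
      (mul_pos hl (K.ε_pos x (hsub hx))).ne'
    have n2 : ∀ x ∈ Ioo K.a K.b, K.A lam x + lam * K.ε x ≠ 0 := fun x hx =>
      (add_pos (A_pos hl (hsub hx)) (mul_pos hl (K.ε_pos x (hsub hx)))).ne'
    have cdψ : ContDiffOn ℝ n (fun x => K.dψ k lam x (φ x) (β x)) (Ioo K.a K.b) := by
      unfold dψ
      exact ContDiffOn.div (by fun_prop) (by fun_prop) n2
    refine ⟨step _ _ h.hφ ?_, step _ _ h.hψ cdψ, step _ _ h.hα ?_, step _ _ h.hβ ?_⟩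
    · unfold dφ
      exact ContDiffOn.add (by fun_prop) (ContDiffOn.div (by fun_prop) (by fun_prop) n1)
    · fun_prop
    · fun_prop

end IsSol

/-- A displacement with value `(0, 1)` at `c` and `(0, 0)` at `w` whose elastic energy vanishes. -/
theorem exists_test (K : Layer) (hk : k ≠ 0) {c w : ℝ} (hc : c ∈ Icc K.a K.b)
    (hcw : c ≠ w) :
    ∃ (φ₁ ψ₁ p q : ℝ → ℝ) (C : ℝ), 0 ≤ C ∧ (∀ x ∈ Icc K.a K.b, HasDerivAt φ₁ (p x) x) ∧
      (∀ x ∈ Icc K.a K.b, HasDerivAt ψ₁ (q x) x) ∧ φ₁ c = 0 ∧ ψ₁ c = 1 ∧ φ₁ w = 0 ∧ ψ₁ w = 0 ∧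
      ∀ lam, 0 < lam → lam ≤ 1 → ∀ x ∈ Icc K.a K.b,
        K.density k lam x (φ₁ x) (ψ₁ x) (p x) (q x) ≤ lam * C := by
  have hwc : w - c ≠ 0 := sub_ne_zero.2 hcw.symm
  set y : ℝ → ℝ := fun x => (x - c) / (w - c) with hy
  have hyc : y c = 0 := by simp [hy]
  have hyw : y w = 1 := by simp [hy, hwc]
  have hyd : ∀ x, HasDerivAt y (1 / (w - c)) x := fun x =>
    ((hasDerivAt_id x).sub_const c).div_const _
  -- A cutoff with `χ = 1`, `χ' = 0` at `c` and `χ = χ' = 0` at `w`; both derivatives matter because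
  -- `φ₁` is a multiple of `χ'`.
  set χ : ℝ → ℝ := fun x => (1 - y x ^ 2) ^ 2
  set χ₁ : ℝ → ℝ := fun x => -4 / (w - c) * (y x - y x ^ 3) with hχ₁
  set χ₂ : ℝ → ℝ := fun x => -4 / (w - c) * (1 / (w - c) - 3 * y x ^ 2 * (1 / (w - c))) with hχ₂
  have hχd : ∀ x, HasDerivAt χ (χ₁ x) x := fun x => by
    refine ((((hyd x).pow 2).const_sub 1).pow 2).congr_deriv ?_
    simp only [hχ₁, Pi.pow_apply]
    field_simp
    ring
  have hχd₁ : ∀ x, HasDerivAt χ₁ (χ₂ x) x := fun x => by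
    refine (((hyd x).sub ((hyd x).pow 3)).const_mul (-4 / (w - c))).congr_deriv ?_
    simp only [hχ₂]
    push_cast
    ring
  have hχc : Continuous χ := continuous_iff_continuousAt.2 fun x => (hχd x).continuousAt
  have hχc₁ : Continuous χ₁ := continuous_iff_continuousAt.2 fun x => (hχd₁ x).continuousAt
  have hyC : Continuous y := continuous_iff_continuousAt.2 fun x => (hyd x).continuousAt
  have hχc₂ : Continuous χ₂ := by fun_prop
  set R := K.ρ c
  have hR : R ≠ 0 := (K.ρ_pos c hc).ne'
  -- The mass flux is taken divergence free, `(ρ ψ₁)' + k ρ φ₁ = 0`. By the hydrostatic balance this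
  -- says exactly that the square multiplied by `π` in the density is zero, leaving only terms with
  -- a factor `λ` or `λ²`.
  set φ₁ : ℝ → ℝ := fun x => -(R / k) * (χ₁ x / K.ρ x) with hφ₁
  set ψ₁ : ℝ → ℝ := fun x => R * (χ x / K.ρ x) with hψ₁
  set p : ℝ → ℝ := fun x => -(R / k) * (χ₂ x / K.ρ x + K.g * χ₁ x / K.π x) with hp
  set q : ℝ → ℝ := fun x => R * (χ₁ x / K.ρ x + K.g * χ x / K.π x) with hq
  have n1 : ∀ x ∈ Icc K.a K.b, K.ρ x ≠ 0 := fun x hx => (K.ρ_pos x hx).ne'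
  have n2 : ∀ x ∈ Icc K.a K.b, K.π x ≠ 0 := fun x hx => (K.π_pos x hx).ne'
  have hpd : ∀ x ∈ Icc K.a K.b, HasDerivAt φ₁ (p x) x := fun x hx => by
    refine (((hχd₁ x).div (K.hydrostatic x hx) (n1 x hx)).const_mul _).congr_deriv ?_
    have := n1 x hx
    have := n2 x hx
    simp only [hp]
    field_simp
    ring
  have hqd : ∀ x ∈ Icc K.a K.b, HasDerivAt ψ₁ (q x) x := fun x hx => by
    refine (((hχd x).div (K.hydrostatic x hx) (n1 x hx)).const_mul _).congr_deriv ?_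
    have := n1 x hx
    have := n2 x hx
    simp only [hq]
    field_simp
    ring
  have cρ : ContinuousOn K.ρ (Icc K.a K.b) := fun x hx =>
    (K.ρ_smooth x hx).continuousAt.continuousWithinAt
  have cε : ContinuousOn K.ε (Icc K.a K.b) := fun x hx =>
    (K.ε_smooth x hx).continuousAt.continuousWithinAt
  have cδ : ContinuousOn K.δ (Icc K.a K.b) := fun x hx =>
    (K.δ_smooth x hx).continuousAt.continuousWithinAt
  have cπ : ContinuousOn K.π (Icc K.a K.b) := fun x hx =>
    (K.π_smooth x hx).continuousAt.continuousWithinAt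
  have cφ : ContinuousOn φ₁ (Icc K.a K.b) := fun x hx => (hpd x hx).continuousAt.continuousWithinAt
  have cψ : ContinuousOn ψ₁ (Icc K.a K.b) := fun x hx => (hqd x hx).continuousAt.continuousWithinAt
  have cp : ContinuousOn p (Icc K.a K.b) :=
    continuousOn_const.mul ((hχc₂.continuousOn.div cρ n1).add
      ((continuous_const.mul hχc₁).continuousOn.div cπ n2))
  have cq : ContinuousOn q (Icc K.a K.b) :=
    continuousOn_const.mul ((hχc₁.continuousOn.div cρ n1).add
      ((continuous_const.mul hχc).continuousOn.div cπ n2))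
  have cB : ContinuousOn (fun x => K.ρ x * (φ₁ x ^ 2 + ψ₁ x ^ 2) + K.ε x * (p x - k * ψ₁ x) ^ 2
      + K.ε x * (q x - k * φ₁ x) ^ 2 + (K.δ x + K.ε x / 3) * (q x + k * φ₁ x) ^ 2)
      (Icc K.a K.b) := by fun_prop
  obtain ⟨C, hC⟩ := isCompact_Icc.bddAbove_image cB
  refine ⟨φ₁, ψ₁, p, q, max C 0, le_max_right _ _, hpd, hqd, ?_, ?_, ?_, ?_,
    fun lam hl hl1 x hx => ?_⟩
  · simp [hφ₁, hχ₁, hyc]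
  · simp [hψ₁, χ, hyc, R, hR]
  · simp [hφ₁, hχ₁, hyw]
  · simp [hψ₁, χ, hyw]
  · have hB := (hC (mem_image_of_mem _ hx)).trans (le_max_left C 0)
    have h0 : q x + k * φ₁ x - K.g * K.ρ x * ψ₁ x / K.π x = 0 := by
      have := n1 x hx
      have := n2 x hx
      simp only [hq, hφ₁, hψ₁]
      field_simp
      ring
    have hρ := K.ρ_pos x hx
    have hsq : lam ^ 2 * (K.ρ x * (φ₁ x ^ 2 + ψ₁ x ^ 2)) ≤
        lam * (K.ρ x * (φ₁ x ^ 2 + ψ₁ x ^ 2)) := by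
      have : lam ^ 2 ≤ lam := by nlinarith
      gcongr
    unfold density
    rw [h0]
    nlinarith

theorem density_smul (K : Layer) (s φ ψ p q : ℝ) :
    K.density k lam x (s * φ) (s * ψ) (s * p) (s * q) = s ^ 2 * K.density k lam x φ ψ p q := by
  unfold density
  ring

end Layer

/-! ### The flow of the first order system -/

namespace Layer

variable (K : Layer) {k lam : ℝ} {φ ψ α β : ℝ → ℝ} {x : ℝ}

/-- The matrix of the first order system of `Layer.IsSol`. -/
def sysMatrix (k lam x : ℝ) : Matrix (Fin 4) (Fin 4) ℝ :=
  !![0, k, 1 / (lam * K.ε x), 0;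
    -(k * (K.A lam x - lam * K.ε x)) / (K.A lam x + lam * K.ε x), 0, 0,
      1 / (K.A lam x + lam * K.ε x);
    lam ^ 2 * K.ρ x - (k * (K.A lam x - lam * K.ε x)) ^ 2 / (K.A lam x + lam * K.ε x)
      + k ^ 2 * (K.A lam x + lam * K.ε x), -(k * K.g * K.ρ x), 0,
      k * (K.A lam x - lam * K.ε x) / (K.A lam x + lam * K.ε x);
    -(k * K.g * K.ρ x), lam ^ 2 * K.ρ x, -k, 0]

/-- The linear map `Matrix.toLin'` with values in the continuous linear maps. -/
def matrixCLM : Matrix (Fin 4) (Fin 4) ℝ →ₗ[ℝ] ((Fin 4 → ℝ) →L[ℝ] (Fin 4 → ℝ)) :=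
  (LinearMap.toContinuousLinearMap (𝕜 := ℝ) (E := Fin 4 → ℝ) (F' := Fin 4 → ℝ)).toLinearMap ∘ₗ
    (Matrix.toLin' (R := ℝ) (m := Fin 4) (n := Fin 4)).toLinearMap

theorem matrixCLM_apply (M : Matrix (Fin 4) (Fin 4) ℝ) (v : Fin 4 → ℝ) :
    matrixCLM M v = M *ᵥ v := rfl

theorem continuous_matrixCLM : Continuous matrixCLM :=
  LinearMap.continuous_of_finiteDimensional _

/-- Writing `λ = exp t` makes the parameter space all of `ℝ`, on which no denominator of the matrix
vanishes. -/
theorem continuous_sysMatrix (k : ℝ) :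
    Continuous fun p : ℝ × Icc K.a K.b => matrixCLM (K.sysMatrix k (Real.exp p.1) p.2) := by
  refine continuous_matrixCLM.comp ?_
  have lift : ∀ f : ℝ → ℝ, (∀ x ∈ Icc K.a K.b, ContDiffAt ℝ ∞ f x) →
      Continuous fun p : ℝ × Icc K.a K.b => f p.2 := fun f hf =>
    (continuousOn_iff_continuous_domRestrict.1
      fun x hx => (hf x hx).continuousAt.continuousWithinAt).comp continuous_snd
  have cρ := lift _ K.ρ_smooth
  have cε := lift _ K.ε_smooth
  have cδ := lift _ K.δ_smooth
  have cπ := lift _ K.π_smooth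
  have cA : Continuous fun p : ℝ × Icc K.a K.b => K.A (Real.exp p.1) p.2 := by
    unfold A
    fun_prop
  have n0 : ∀ p : ℝ × Icc K.a K.b, Real.exp p.1 ≠ 0 := fun p => (Real.exp_pos _).ne'
  have n1 : ∀ p : ℝ × Icc K.a K.b, K.ε p.2 ≠ 0 := fun p => (K.ε_pos _ p.2.2).ne'
  have n2 : ∀ p : ℝ × Icc K.a K.b, K.A (Real.exp p.1) p.2 + Real.exp p.1 * K.ε p.2 ≠ 0 :=
    fun p => (add_pos (A_pos (Real.exp_pos _) p.2.2)
      (mul_pos (Real.exp_pos _) (K.ε_pos _ p.2.2))).ne'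
  refine continuous_matrix fun i j => ?_
  fin_cases i <;> fin_cases j <;> simp [sysMatrix] <;> fun_prop (disch := assumption)

variable {K}

theorem isSol_of_hasDerivAt (hl : 0 < lam) {y : ℝ → Fin 4 → ℝ}
    (hy : ∀ x ∈ Icc K.a K.b, HasDerivAt y (matrixCLM (K.sysMatrix k lam x) (y x)) x) :
    K.IsSol k lam (fun x => y x 0) (fun x => y x 1) (fun x => y x 2) (fun x => y x 3) := by
  have H := fun x hx => hasDerivAt_pi.1 (hy x hx)
  have n1 : ∀ x ∈ Icc K.a K.b, K.ε x ≠ 0 := fun x hx => (K.ε_pos _ hx).ne'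
  have n2 : ∀ x ∈ Icc K.a K.b, K.A lam x + lam * K.ε x ≠ 0 :=
    fun x hx => (add_pos (A_pos hl hx) (mul_pos hl (K.ε_pos _ hx))).ne'
  constructor <;> intro x hx <;> have a1 := n1 x hx <;> have a2 := n2 x hx
  · refine (H x hx 0).congr_deriv ?_
    simp [matrixCLM_apply, sysMatrix, Matrix.mulVec, dotProduct, Fin.sum_univ_four, dφ]
    field_simp
  · refine (H x hx 1).congr_deriv ?_
    simp [matrixCLM_apply, sysMatrix, Matrix.mulVec, dotProduct, Fin.sum_univ_four, dψ]
    field_simp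
    ring
  · refine (H x hx 2).congr_deriv ?_
    simp [matrixCLM_apply, sysMatrix, Matrix.mulVec, dotProduct, Fin.sum_univ_four, dψ]
    field_simp
    ring
  · refine (H x hx 3).congr_deriv ?_
    simp [matrixCLM_apply, sysMatrix, Matrix.mulVec, dotProduct, Fin.sum_univ_four]
    ring

variable (K) (k)

theorem exists_flow_right :
    ∃ Φ : ℝ → (Fin 4 → ℝ) →L[ℝ] (Fin 4 → ℝ), Continuous Φ ∧ ∀ t v, ∃ y : ℝ → Fin 4 → ℝ,
      y K.a = v ∧ y K.b = Φ t v ∧ K.IsSol k (Real.exp t) (fun x => y x 0) (fun x => y x 1)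
        (fun x => y x 2) (fun x => y x 3) := by
  obtain ⟨Φ, hΦ, h⟩ := exists_linear_flow K.a_lt_b.le
    (fun t x => matrixCLM (K.sysMatrix k (Real.exp t) x)) (K.continuous_sysMatrix k)
  refine ⟨Φ, hΦ, fun t v => ?_⟩
  obtain ⟨y, h1, h2, h3⟩ := h t v
  exact ⟨y, h1, h2, isSol_of_hasDerivAt (Real.exp_pos t) h3⟩

theorem exists_flow_left :
    ∃ Φ : ℝ → (Fin 4 → ℝ) →L[ℝ] (Fin 4 → ℝ), Continuous Φ ∧ ∀ t v, ∃ y : ℝ → Fin 4 → ℝ,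
      y K.b = v ∧ y K.a = Φ t v ∧ K.IsSol k (Real.exp t) (fun x => y x 0) (fun x => y x 1)
        (fun x => y x 2) (fun x => y x 3) := by
  obtain ⟨Φ, hΦ, h⟩ := exists_linear_flow_left K.a_lt_b.le
    (fun t x => matrixCLM (K.sysMatrix k (Real.exp t) x)) (K.continuous_sysMatrix k)
  refine ⟨Φ, hΦ, fun t v => ?_⟩
  obtain ⟨y, h1, h2, h3⟩ := h t v
  exact ⟨y, h1, h2, isSol_of_hasDerivAt (Real.exp_pos t) h3⟩

end Layer

/-! ### The enthalpy, its inverse and the steady density -/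

namespace IsPressureLaw

variable {P : ℝ → ℝ} {g c : ℝ}

theorem contDiffOn_deriv (hP : IsPressureLaw P) : ContDiffOn ℝ ∞ (deriv P) (Ioi 0) :=
  ((contDiffOn_infty_iff_deriv_of_isOpen isOpen_Ioi).1 hP.smooth).2

theorem hasDerivAt_enthalpy (hP : IsPressureLaw P) {z : ℝ} (hz : 0 < z) :
    HasDerivAt (enthalpy P) (deriv P z / z) z := by
  have hc : ContinuousOn (fun r => deriv P r / r) (Ioi 0) :=
    hP.contDiffOn_deriv.continuousOn.div continuousOn_id fun r hr => (ne_of_gt hr)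
  have hsub : uIcc 1 z ⊆ Ioi 0 := fun r hr => lt_of_lt_of_le (lt_min one_pos hz) hr.1
  exact intervalIntegral.integral_hasDerivAt_right
    (hc.mono hsub).intervalIntegrable
    (hc.stronglyMeasurableAtFilter isOpen_Ioi z hz) (hc.continuousAt (Ioi_mem_nhds hz))

theorem contDiffOn_enthalpy (hP : IsPressureLaw P) : ContDiffOn ℝ ∞ (enthalpy P) (Ioi 0) := by
  rw [contDiffOn_infty_iff_deriv_of_isOpen isOpen_Ioi]
  refine ⟨fun z hz => (hP.hasDerivAt_enthalpy hz).differentiableAt.differentiableWithinAt,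
    (hP.contDiffOn_deriv.div contDiffOn_id fun r hr => (ne_of_gt hr)).congr
      fun z hz => (hP.hasDerivAt_enthalpy hz).deriv⟩

theorem strictMonoOn_enthalpy (hP : IsPressureLaw P) : StrictMonoOn (enthalpy P) (Ioi 0) := by
  refine strictMonoOn_of_deriv_pos (convex_Ioi 0) hP.contDiffOn_enthalpy.continuousOn
    fun z hz => ?_
  rw [interior_Ioi] at hz
  rw [(hP.hasDerivAt_enthalpy hz).deriv]
  exact div_pos (hP.deriv_pos z hz) hz

/-- The inverse of the enthalpy on `(0, ∞)`. -/
def enthalpyInv (P : ℝ → ℝ) : ℝ → ℝ := Function.invFunOn (enthalpy P) (Ioi 0)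

theorem enthalpyInv_pos {t : ℝ} (ht : t ∈ enthalpy P '' Ioi 0) : 0 < enthalpyInv P t :=
  Function.invFunOn_mem ht

theorem enthalpy_enthalpyInv {t : ℝ} (ht : t ∈ enthalpy P '' Ioi 0) :
    enthalpy P (enthalpyInv P t) = t :=
  Function.invFunOn_eq ht

theorem enthalpyInv_enthalpy (hP : IsPressureLaw P) {z : ℝ} (hz : 0 < z) :
    enthalpyInv P (enthalpy P z) = z :=
  hP.strictMonoOn_enthalpy.injOn.leftInvOn_invFunOn hz

/-- The inverse function theorem provides a smooth local inverse. By continuity its values stay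
positive near the given point, and there injectivity of the enthalpy on `(0, ∞)` identifies it with
`enthalpyInv`. -/
theorem contDiffAt_enthalpyInv (hP : IsPressureLaw P) {t : ℝ} (ht : t ∈ enthalpy P '' Ioi 0) :
    ContDiffAt ℝ ∞ (enthalpyInv P) t := by
  obtain ⟨z, hz, rfl⟩ := ht
  have hc : ContDiffAt ℝ ∞ (enthalpy P) z := hP.contDiffOn_enthalpy.contDiffAt (Ioi_mem_nhds hz)
  have hd := hP.hasDerivAt_enthalpy hz
  have hne : deriv P z / z ≠ 0 := (div_pos (hP.deriv_pos z hz) hz).ne'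
  have hd' : HasFDerivAt (enthalpy P)
      ((ContinuousLinearEquiv.unitsEquivAut ℝ (Units.mk0 _ hne) : ℝ ≃L[ℝ] ℝ) : ℝ →L[ℝ] ℝ) z :=
    hd.hasFDerivAt_equiv hne
  have hinv := hc.to_localInverse hd' (by simp)
  refine hinv.congr_of_eventuallyEq ?_
  have hs : HasStrictFDerivAt (enthalpy P)
      ((ContinuousLinearEquiv.unitsEquivAut ℝ (Units.mk0 _ hne) : ℝ ≃L[ℝ] ℝ) : ℝ →L[ℝ] ℝ) z :=
    hc.hasStrictFDerivAt' hd' (by simp)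
  have h1 := hs.eventually_right_inverse
  have h2 : ∀ᶠ y in 𝓝 (enthalpy P z), 0 < hc.localInverse hd' (by simp) y := by
    have h3 := hinv.continuousAt
    have h4 : hc.localInverse hd' (by simp) (enthalpy P z) = z := hs.localInverse_apply_image
    exact h3.eventually (by rw [h4]; exact lt_mem_nhds hz)
  filter_upwards [h1, h2] with y hy1 hy2
  have h5 : enthalpy P (hc.localInverse hd' (by simp) y) = y := hy1
  conv_lhs => rw [← h5]
  exact hP.enthalpyInv_enthalpy hy2

theorem contDiffAt_profile (hP : IsPressureLaw P) {x : ℝ} (hx : c - g * x ∈ enthalpy P '' Ioi 0) :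
    ContDiffAt ℝ ∞ (fun x => enthalpyInv P (c - g * x)) x :=
  (hP.contDiffAt_enthalpyInv hx).comp x (f := fun x => c - g * x) (by fun_prop)

/-- Differentiate `h(ρ(x)) = c - g x`. This identity holds in a neighbourhood of `x` because the
range of the enthalpy is a neighbourhood of each of its points. -/
theorem hasDerivAt_profile (hP : IsPressureLaw P) {x : ℝ} (hx : c - g * x ∈ enthalpy P '' Ioi 0) :
    HasDerivAt (fun x => enthalpyInv P (c - g * x))
      (-(g * enthalpyInv P (c - g * x) / deriv P (enthalpyInv P (c - g * x)))) x := by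
  have hd := ((hP.contDiffAt_profile hx).differentiableAt (by simp)).hasDerivAt
  have hpos := enthalpyInv_pos hx
  have h1 := (hP.hasDerivAt_enthalpy hpos).comp x hd
  have h2 : enthalpy P ∘ (fun x => enthalpyInv P (c - g * x)) =ᶠ[𝓝 x] fun x => c - g * x := by
    have h3 : ∀ᶠ y in 𝓝 x, c - g * y ∈ enthalpy P '' Ioi 0 := by
      have hopen : enthalpy P '' Ioi 0 ∈ 𝓝 (c - g * x) := by
        obtain ⟨z, hz, hzx⟩ := hx
        have hs : HasStrictDerivAt (enthalpy P) (deriv P z / z) z :=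
          (hP.contDiffOn_enthalpy.contDiffAt (Ioi_mem_nhds hz)).hasStrictDerivAt'
            (hP.hasDerivAt_enthalpy hz) (by simp)
        rw [← hzx, ← hs.map_nhds_eq (div_pos (hP.deriv_pos z hz) hz).ne']
        exact image_mem_map (Ioi_mem_nhds hz)
      exact (by fun_prop : Continuous fun y => c - g * y).continuousAt.eventually hopen
    filter_upwards [h3] with y hy using enthalpy_enthalpyInv hy
  have h4 : HasDerivAt (fun x => c - g * x) (-g) x := by
    simpa using ((hasDerivAt_id x).const_mul g).const_sub c
  have h5 := (h4.congr_of_eventuallyEq h2).unique h1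
  have hP' := hP.deriv_pos _ hpos
  refine hd.congr_deriv ?_
  field_simp at h5 ⊢
  linarith

end IsPressureLaw

open IsPressureLaw in
/-- The layer `[a, b]` filled with a fluid in hydrostatic equilibrium. -/
def hydrostaticLayer {P ε δ : ℝ → ℝ} {a b g c : ℝ} (hP : IsPressureLaw P)
    (hε : ContDiffOn ℝ ∞ ε (Ioi 0)) (hδ : ContDiffOn ℝ ∞ δ (Ioi 0))
    (hε0 : ∀ z, 0 < z → 0 < ε z) (hδ0 : ∀ z, 0 < z → 0 ≤ δ z) (hab : a < b)
    (hx : ∀ x ∈ Icc a b, c - g * x ∈ enthalpy P '' Ioi 0) : Layer where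
  a := a
  b := b
  g := g
  ρ x := enthalpyInv P (c - g * x)
  ε x := ε (enthalpyInv P (c - g * x))
  δ x := δ (enthalpyInv P (c - g * x))
  π x := deriv P (enthalpyInv P (c - g * x)) * enthalpyInv P (c - g * x)
  a_lt_b := hab
  ρ_smooth x h := hP.contDiffAt_profile (hx x h)
  ε_smooth x h := (hε.contDiffAt (Ioi_mem_nhds (enthalpyInv_pos (hx x h)))).comp x
    (hP.contDiffAt_profile (hx x h))
  δ_smooth x h := (hδ.contDiffAt (Ioi_mem_nhds (enthalpyInv_pos (hx x h)))).comp x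
    (hP.contDiffAt_profile (hx x h))
  π_smooth x h :=
    have h1 : ContDiffAt ℝ ∞ (fun x => deriv P (enthalpyInv P (c - g * x))) x :=
      ContDiffAt.comp (g := deriv P) x
        (hP.contDiffOn_deriv.contDiffAt (Ioi_mem_nhds (enthalpyInv_pos (hx x h))))
        (hP.contDiffAt_profile (hx x h))
    h1.mul (hP.contDiffAt_profile (hx x h))
  ρ_pos x h := enthalpyInv_pos (hx x h)
  ε_pos x h := hε0 _ (enthalpyInv_pos (hx x h))
  δ_nonneg x h := hδ0 _ (enthalpyInv_pos (hx x h))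
  π_pos x h := mul_pos (hP.deriv_pos _ (enthalpyInv_pos (hx x h))) (enthalpyInv_pos (hx x h))
  hydrostatic x h := by
    refine (hP.hasDerivAt_profile (hx x h)).congr_deriv ?_
    have h1 := enthalpyInv_pos (hx x h)
    have h2 := hP.deriv_pos _ h1
    field_simp

/-- The range is an interval, so the nondegeneracy hypotheses are needed only at the ends of a
layer. -/
theorem IsPressureLaw.mem_range_of_mem {P : ℝ → ℝ} (hP : IsPressureLaw P) {s t u : ℝ}
    (hs : s ∈ enthalpy P '' Ioi 0) (ht : t ∈ enthalpy P '' Ioi 0) (hu : u ∈ Icc s t) :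
    u ∈ enthalpy P '' Ioi 0 :=
  (isPreconnected_Ioi.image _ hP.contDiffOn_enthalpy.continuousOn).ordConnected.out hs ht hu

/-! ### The two layers of the steady state -/

namespace RTParams

variable (D : RTParams)

/-- The lower layer in the steady state. -/
def lower : Layer :=
  hydrostaticLayer (a := -D.m) (b := 0) (g := D.g) (c := enthalpy D.Pm D.ρm) D.Pm_law D.εm_smooth
    D.δm_smooth D.εm_pos D.δm_nonneg (neg_lt_zero.2 D.m_pos) (fun x hx =>
      D.Pm_law.mem_range_of_mem (mem_image_of_mem _ D.ρm_pos) D.lower_range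
        ⟨by nlinarith [D.g_pos, hx.2], by nlinarith [D.g_pos, hx.1]⟩)

/-- The upper layer in the steady state. -/
def upper : Layer :=
  hydrostaticLayer (a := 0) (b := D.ell) (g := D.g) (c := enthalpy D.Pp D.ρp) D.Pp_law D.εp_smooth
    D.δp_smooth D.εp_pos D.δp_nonneg D.ell_pos (fun x hx =>
      D.Pp_law.mem_range_of_mem D.upper_range (mem_image_of_mem _ D.ρp_pos)
        ⟨by nlinarith [D.g_pos, hx.2], by nlinarith [D.g_pos, hx.1]⟩)

theorem lower_ρ_zero : D.lower.ρ 0 = D.ρm := by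
  simpa [lower, hydrostaticLayer] using D.Pm_law.enthalpyInv_enthalpy D.ρm_pos

theorem upper_ρ_zero : D.upper.ρ 0 = D.ρp := by
  simpa [upper, hydrostaticLayer] using D.Pp_law.enthalpyInv_enthalpy D.ρp_pos

variable {x : ℝ} (lam : ℝ)

theorem rho0_of_neg (hx : x < 0) : D.rho0 x = D.lower.ρ x := if_pos hx

theorem rho0_of_nonneg (hx : 0 ≤ x) : D.rho0 x = D.upper.ρ x := if_neg hx.not_gt

theorem eps0_of_neg (hx : x < 0) : D.eps0 x = D.lower.ε x := by
  rw [eps0, if_pos hx, D.rho0_of_neg hx]; rfl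

theorem eps0_of_nonneg (hx : 0 ≤ x) : D.eps0 x = D.upper.ε x := by
  rw [eps0, if_neg hx.not_gt, D.rho0_of_nonneg hx]; rfl

theorem del0_of_neg (hx : x < 0) : D.del0 x = D.lower.δ x := by
  rw [del0, if_pos hx, D.rho0_of_neg hx]; rfl

theorem del0_of_nonneg (hx : 0 ≤ x) : D.del0 x = D.upper.δ x := by
  rw [del0, if_neg hx.not_gt, D.rho0_of_nonneg hx]; rfl

theorem pr0_of_neg (hx : x < 0) : D.pr0 x = D.lower.π x := by
  rw [pr0, if_pos hx, D.rho0_of_neg hx]; rfl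

theorem pr0_of_nonneg (hx : 0 ≤ x) : D.pr0 x = D.upper.π x := by
  rw [pr0, if_neg hx.not_gt, D.rho0_of_nonneg hx]; rfl

theorem coefA_of_neg (hx : x < 0) : D.coefA lam x = D.lower.A lam x := by
  rw [coefA, D.del0_of_neg hx, D.eps0_of_neg hx, D.pr0_of_neg hx]; rfl

theorem coefA_of_nonneg (hx : 0 ≤ x) : D.coefA lam x = D.upper.A lam x := by
  rw [coefA, D.del0_of_nonneg hx, D.eps0_of_nonneg hx, D.pr0_of_nonneg hx]; rfl

end RTParams

/-! ### Matching at the interface and existence of a growth rate -/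

namespace Layer

/-- Solutions in the lower layer `K₁` and the upper layer `K₂` that vanish at the walls and are
matched at the interface up to a defect `c` in the jump condition for the normal stress. -/
structure IsMatched (K₁ K₂ : Layer) (k τ lam c : ℝ) (y₁ y₂ : ℝ → Fin 4 → ℝ) : Prop where
  sol₁ : K₁.IsSol k lam (fun x => y₁ x 0) (fun x => y₁ x 1) (fun x => y₁ x 2) (fun x => y₁ x 3)
  sol₂ : K₂.IsSol k lam (fun x => y₂ x 0) (fun x => y₂ x 1) (fun x => y₂ x 2) (fun x => y₂ x 3)
  wall₁ : y₁ K₁.a 0 = 0 ∧ y₁ K₁.a 1 = 0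
  wall₂ : y₂ K₂.b 0 = 0 ∧ y₂ K₂.b 1 = 0
  jump0 : y₂ K₂.a 0 = y₁ K₁.b 0
  jump1 : y₂ K₂.a 1 = y₁ K₁.b 1
  jump2 : y₂ K₂.a 2 = y₁ K₁.b 2
  jump3 : y₂ K₂.a 3 = y₁ K₁.b 3 + τ * y₁ K₁.b 1 + c

variable {K₁ K₂ : Layer} {k τ lam c : ℝ} {y₁ y₂ : ℝ → Fin 4 → ℝ}

/-- The defect `c` and the term with `τ` enter the energy balance only multiplied by `ψ(0)`. If that
is zero, the flux `α φ` at the interface is nonnegative seen from below and nonpositive seen from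
above, so no energy is produced in either layer. -/
theorem IsMatched.eq_zero (h : IsMatched K₁ K₂ k τ lam c y₁ y₂) (hl : 0 < lam)
    (h0 : y₁ K₁.b 1 = 0) :
    (∀ x ∈ Icc K₁.a K₁.b, y₁ x = 0) ∧ ∀ x ∈ Icc K₂.a K₂.b, y₂ x = 0 := by
  obtain ⟨w1, w2⟩ := h.wall₁
  obtain ⟨w3, w4⟩ := h.wall₂
  have m1 := h.sol₁.monotoneOn_energy hl (left_mem_Icc.2 K₁.a_lt_b.le)
    (right_mem_Icc.2 K₁.a_lt_b.le) K₁.a_lt_b.le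
  have m2 := h.sol₂.monotoneOn_energy hl (left_mem_Icc.2 K₂.a_lt_b.le)
    (right_mem_Icc.2 K₂.a_lt_b.le) K₂.a_lt_b.le
  simp only [w1, w2, w3, w4, h.jump0, h.jump1, h.jump2, h0] at m1 m2
  have z1 := h.sol₁.eq_zero_of_energy_eq hl (by simp only [w1, w2, h0]; linarith)
  have z2 := h.sol₂.eq_zero_of_energy_eq hl (by
    simp only [w3, w4, h.jump0, h.jump1, h.jump2, h0]; linarith)
  constructor
  · intro x hx
    obtain ⟨h1, h2, h3, h4⟩ := z1 x hx
    ext i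
    fin_cases i <;> assumption
  · intro x hx
    obtain ⟨h1, h2, h3, h4⟩ := z2 x hx
    ext i
    fin_cases i <;> assumption

/-- The lower layer alone has energy at least `κ s²` and the upper one at least `0`, while the total
is `κ s² - s`. -/
theorem IsMatched.nonpos_of_large (hk : 0 ≤ k)
    (hκ : 0 ≤ K₂.g * K₂.ρ K₂.a - K₁.g * K₁.ρ K₁.b - τ) :
    ∃ Λ, 0 < Λ ∧ ∀ lam, Λ ≤ lam → ∀ y₁ y₂, IsMatched K₁ K₂ k τ lam 1 y₁ y₂ → y₁ K₁.b 1 ≤ 0 := by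
  obtain ⟨Λ, hΛ, H⟩ := IsSol.monotoneOn_energy_sub K₁ hk hκ
  refine ⟨Λ, hΛ, fun lam hlam y₁ y₂ h => ?_⟩
  obtain ⟨w1, w2⟩ := h.wall₁
  obtain ⟨w3, w4⟩ := h.wall₂
  have m1 := H lam hlam _ _ _ _ h.sol₁ (left_mem_Icc.2 K₁.a_lt_b.le)
    (right_mem_Icc.2 K₁.a_lt_b.le) K₁.a_lt_b.le
  have m2 := h.sol₂.monotoneOn_energy (hΛ.trans_le hlam) (left_mem_Icc.2 K₂.a_lt_b.le)
    (right_mem_Icc.2 K₂.a_lt_b.le) K₂.a_lt_b.le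
  simp only [w1, w2, w3, w4, h.jump0, h.jump1, h.jump2, h.jump3] at m1 m2
  linarith

/-- Comparison with `s` times the test displacements, which have the same vertical trace `s` at the
interface, gives `κ s² - s ≤ λ M s²`; the terms `α φ` of the two layers cancel. -/
theorem IsMatched.nonneg_of_small (hk : k ≠ 0)
    (hκ : 0 < K₂.g * K₂.ρ K₂.a - K₁.g * K₁.ρ K₁.b - τ) :
    ∃ Λ, 0 < Λ ∧ ∀ lam, 0 < lam → lam ≤ Λ → ∀ y₁ y₂, IsMatched K₁ K₂ k τ lam 1 y₁ y₂ →
      0 ≤ y₁ K₁.b 1 := by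
  obtain ⟨φ₁, ψ₁, p₁, q₁, C₁, hC₁, a1, a2, a3, a4, a5, a6, a7⟩ :=
    exists_test K₁ hk (right_mem_Icc.2 K₁.a_lt_b.le) K₁.a_lt_b.ne'
  obtain ⟨φ₂, ψ₂, p₂, q₂, C₂, hC₂, b1, b2, b3, b4, b5, b6, b7⟩ :=
    exists_test K₂ hk (left_mem_Icc.2 K₂.a_lt_b.le) K₂.a_lt_b.ne
  set κ := K₂.g * K₂.ρ K₂.a - K₁.g * K₁.ρ K₁.b - τ with hκdef
  have l1 := sub_pos.2 K₁.a_lt_b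
  have l2 := sub_pos.2 K₂.a_lt_b
  set M := C₁ * (K₁.b - K₁.a) + C₂ * (K₂.b - K₂.a) with hM
  have hM0 : 0 ≤ M := by positivity
  -- The test bounds require `λ ≤ 1`; the other entry gives `λ M ≤ κ`, with `M + 1` in place of `M`
  -- since `M` may be zero.
  refine ⟨min 1 (κ / (M + 1)), by positivity, fun lam hl hlam y₁ y₂ h => ?_⟩
  have hl1 : lam ≤ 1 := hlam.trans (min_le_left _ _)
  have hlM : lam * M ≤ κ := by
    have := hlam.trans (min_le_right _ _)
    rw [le_div_iff₀ (by positivity)] at this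
    nlinarith
  obtain ⟨w1, w2⟩ := h.wall₁
  obtain ⟨w3, w4⟩ := h.wall₂
  set s := y₁ K₁.b 1 with hs
  have c1 := h.sol₁.comparison_le hl (fun x hx => (a1 x hx).const_mul s)
    (fun x hx => (a2 x hx).const_mul s) (M := s ^ 2 * (lam * C₁)) (fun x hx => by
      rw [density_smul]
      exact mul_le_mul_of_nonneg_left (a7 lam hl hl1 x hx) (sq_nonneg s))
  have c2 := h.sol₂.comparison_le hl (fun x hx => (b1 x hx).const_mul s)
    (fun x hx => (b2 x hx).const_mul s) (M := s ^ 2 * (lam * C₂)) (fun x hx => by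
      rw [density_smul]
      exact mul_le_mul_of_nonneg_left (b7 lam hl hl1 x hx) (sq_nonneg s))
  simp only [w1, w2, w3, w4, h.jump0, h.jump1, h.jump2, h.jump3, a3, a4, a5, a6, b3, b4, b5, b6,
    ← hs] at c1 c2
  have h3 : s ^ 2 * (lam * M) ≤ s ^ 2 * κ := by gcongr
  have h4 : s ^ 2 * (lam * M) = s ^ 2 * (lam * C₁) * (K₁.b - K₁.a)
      + s ^ 2 * (lam * C₂) * (K₂.b - K₂.a) := by rw [hM]; ring
  rw [h4, hκdef] at h3
  nlinarith

/-- A growth rate for which the homogeneous matching problem has a nontrivial solution. -/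
theorem exists_isMatched (hk : 0 < k)
    (hκ : 0 < K₂.g * K₂.ρ K₂.a - K₁.g * K₁.ρ K₁.b - τ) :
    ∃ lam y₁ y₂, 0 < lam ∧ IsMatched K₁ K₂ k τ lam 0 y₁ y₂ ∧ y₁ K₁.b 1 ≠ 0 := by
  obtain ⟨Φ₁, hΦ₁, H₁⟩ := K₁.exists_flow_right k
  obtain ⟨Φ₂, hΦ₂, H₂⟩ := K₂.exists_flow_left k
  -- The vector `p` lists the stresses `(α, β)` at the lower wall and then at the upper wall. `J₁`
  -- and `J₂` turn them into initial values with zero displacement, and `S` carries the lower trace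
  -- across the interface.
  let J₁ : (Fin 4 → ℝ) →L[ℝ] (Fin 4 → ℝ) :=
    matrixCLM !![0, 0, 0, 0; 0, 0, 0, 0; 1, 0, 0, 0; 0, 1, 0, 0]
  let J₂ : (Fin 4 → ℝ) →L[ℝ] (Fin 4 → ℝ) :=
    matrixCLM !![0, 0, 0, 0; 0, 0, 0, 0; 0, 0, 1, 0; 0, 0, 0, 1]
  let S : (Fin 4 → ℝ) →L[ℝ] (Fin 4 → ℝ) :=
    matrixCLM !![1, 0, 0, 0; 0, 1, 0, 0; 0, 0, 1, 0; 0, τ, 0, 1]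
  have J₁_apply : ∀ p, J₁ p = ![0, 0, p 0, p 1] := fun p => by
    ext i
    fin_cases i <;> simp [J₁, matrixCLM_apply, Matrix.mulVec, dotProduct, Fin.sum_univ_four]
  have J₂_apply : ∀ p, J₂ p = ![0, 0, p 2, p 3] := fun p => by
    ext i
    fin_cases i <;> simp [J₂, matrixCLM_apply, Matrix.mulVec, dotProduct, Fin.sum_univ_four]
  have S_apply : ∀ p, S p = ![p 0, p 1, p 2, τ * p 1 + p 3] := fun p => by
    ext i
    fin_cases i <;> simp [S, matrixCLM_apply, Matrix.mulVec, dotProduct, Fin.sum_univ_four]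
  let T : ℝ → (Fin 4 → ℝ) →L[ℝ] (Fin 4 → ℝ) := fun t => Φ₂ t * J₂ - S * (Φ₁ t * J₁)
  have hT : Continuous T := by fun_prop
  have match_of : ∀ t p c, T t p = ![0, 0, 0, c] → ∃ y₁ y₂,
      IsMatched K₁ K₂ k τ (Real.exp t) c y₁ y₂ ∧ y₁ K₁.b = Φ₁ t (J₁ p) ∧ y₁ K₁.a = J₁ p ∧
        y₂ K₂.b = J₂ p := by
    intro t p c hp
    obtain ⟨y₁, u1, u2, u3⟩ := H₁ t (J₁ p)
    obtain ⟨y₂, v1, v2, v3⟩ := H₂ t (J₂ p)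
    have hp' : y₂ K₂.a - S (y₁ K₁.b) = ![0, 0, 0, c] := by
      rw [← hp, u2, v2]
      rfl
    rw [S_apply] at hp'
    have j0 := congrFun hp' 0
    have j1 := congrFun hp' 1
    have j2 := congrFun hp' 2
    have j3 := congrFun hp' 3
    simp at j0 j1 j2 j3
    refine ⟨y₁, y₂, ⟨u3, v3, ?_, ?_, ?_, ?_, ?_, ?_⟩, u2, u1, v1⟩
    · simp [u1, J₁_apply]
    · simp [v1, J₂_apply]
    all_goals linarith
  have trivial_of : ∀ t p c, T t p = ![0, 0, 0, c] → Φ₁ t (J₁ p) 1 = 0 → p = 0 := by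
    intro t p c hp h0
    obtain ⟨y₁, y₂, hm, e1, e2, e3⟩ := match_of t p c hp
    obtain ⟨z1, z2⟩ := hm.eq_zero (Real.exp_pos t) (by rw [e1, h0])
    have f1 := e2 ▸ z1 _ (left_mem_Icc.2 K₁.a_lt_b.le)
    have f2 := e3 ▸ z2 _ (right_mem_Icc.2 K₂.a_lt_b.le)
    rw [J₁_apply] at f1
    rw [J₂_apply] at f2
    ext i
    fin_cases i
    · exact congrFun f1 2
    · exact congrFun f1 3
    · exact congrFun f2 2
    · exact congrFun f2 3
  -- If no `T t` is singular, the response to a unit defect exists for all `t` and yields a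
  -- contradiction; otherwise a kernel vector is the mode.
  by_cases hinj : ∀ t, Function.Injective (T t)
  · exfalso
    have hunit : ∀ t, IsUnit (T t) := fun t =>
      ContinuousLinearMap.isUnit_iff_bijective.2
        ⟨hinj t, LinearMap.injective_iff_surjective.1 (hinj t)⟩
    let p : ℝ → Fin 4 → ℝ := fun t => Ring.inverse (T t) ![0, 0, 0, 1]
    have hp : ∀ t, T t (p t) = ![0, 0, 0, 1] := fun t =>
      congrArg (fun L : (Fin 4 → ℝ) →L[ℝ] (Fin 4 → ℝ) => L ![0, 0, 0, 1])
        (Ring.mul_inverse_cancel _ (hunit t))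
    have hpc : Continuous p := by
      refine Continuous.clm_apply ?_ continuous_const
      rw [continuous_iff_continuousAt]
      intro t
      obtain ⟨U, hU⟩ := hunit t
      have h1 := NormedRing.inverse_continuousAt (R := (Fin 4 → ℝ) →L[ℝ] (Fin 4 → ℝ)) U
      rw [hU] at h1
      exact ContinuousAt.comp (f := T) h1 hT.continuousAt
    have hne : ∀ t, Φ₁ t (J₁ (p t)) 1 ≠ 0 := fun t h0 => by
      have h1 := hp t
      rw [trivial_of t _ _ h1 h0, map_zero] at h1
      simpa using congrFun h1 3
    have hc : Continuous fun t => Φ₁ t (J₁ (p t)) 1 := by fun_prop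
    obtain ⟨Λ₁, hΛ₁, B₁⟩ := IsMatched.nonpos_of_large (K₁ := K₁) (K₂ := K₂) hk.le hκ.le
    obtain ⟨Λ₂, hΛ₂, B₂⟩ := IsMatched.nonneg_of_small (K₁ := K₁) (K₂ := K₂) hk.ne' hκ
    have s1 : Φ₁ (Real.log Λ₁) (J₁ (p (Real.log Λ₁))) 1 ≤ 0 := by
      obtain ⟨y₁, y₂, hm, e1, -⟩ := match_of _ _ _ (hp (Real.log Λ₁))
      rw [← e1]
      exact B₁ _ (Real.exp_log hΛ₁).ge _ _ hm
    have s2 : 0 ≤ Φ₁ (Real.log Λ₂) (J₁ (p (Real.log Λ₂))) 1 := by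
      obtain ⟨y₁, y₂, hm, e1, -⟩ := match_of _ _ _ (hp (Real.log Λ₂))
      rw [← e1]
      exact B₂ _ (Real.exp_pos _) (Real.exp_log hΛ₂).le _ _ hm
    obtain ⟨t, ht⟩ := mem_range_of_exists_le_of_exists_ge hc ⟨_, s1⟩ ⟨_, s2⟩
    exact hne t ht
  · push Not at hinj
    obtain ⟨t, ht⟩ := hinj
    rw [← ContinuousLinearMap.coe_coe, ← LinearMap.ker_eq_bot, LinearMap.ker_eq_bot'] at ht
    push Not at ht
    obtain ⟨p, hp, hp0⟩ := ht
    have hp' : T t p = ![0, 0, 0, 0] := by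
      refine Eq.trans hp ?_
      ext i
      fin_cases i <;> rfl
    obtain ⟨y₁, y₂, hm, e1, -⟩ := match_of t p 0 hp'
    exact ⟨Real.exp t, y₁, y₂, Real.exp_pos t, hm, fun h0 =>
      hp0 (trivial_of t p 0 hp' (by rw [← e1, h0]))⟩

end Layer

/-! ### Rotated solutions satisfy the second order equations -/

namespace Layer

variable {K : Layer} {k lam : ℝ} {F G α β : ℝ → ℝ} {φ θ ψ E A N : ℝ → ℝ} {n₀ n₁ : ℝ}

namespace IsSol

theorem deriv_horizontal (h : K.IsSol k lam F G α β)
    (hφ : ∀ x ∈ Ioo K.a K.b, φ x = n₀ * F x) {x : ℝ} (hx : x ∈ Ioo K.a K.b) :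
    deriv φ x = n₀ * K.dφ k lam x (G x) (α x) := by
  have e : φ =ᶠ[𝓝 x] fun y => n₀ * F y :=
    (eventually_of_mem (Ioo_mem_nhds hx.1 hx.2)) hφ
  exact (((h.hφ x (Ioo_subset_Icc_self hx)).const_mul n₀).congr_of_eventuallyEq e).deriv

theorem deriv_vertical (h : K.IsSol k lam F G α β)
    (hψ : ∀ x ∈ Ioo K.a K.b, ψ x = G x) {x : ℝ} (hx : x ∈ Ioo K.a K.b) :
    deriv ψ x = K.dψ k lam x (F x) (β x) := by
  have e : ψ =ᶠ[𝓝 x] G := (eventually_of_mem (Ioo_mem_nhds hx.1 hx.2)) hψ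
  exact ((h.hψ x (Ioo_subset_Icc_self hx)).congr_of_eventuallyEq e).deriv

/-- The shear stress of a rotated solution. -/
theorem shear_eq (h : K.IsSol k lam F G α β) (hl : 0 < lam)
    (hE : ∀ x ∈ Ioo K.a K.b, E x = K.ε x)
    (hφ : ∀ x ∈ Ioo K.a K.b, φ x = n₀ * F x) (hψ : ∀ x ∈ Ioo K.a K.b, ψ x = G x)
    {x : ℝ} (hx : x ∈ Ioo K.a K.b) :
    lam * E x * (deriv φ x - k * n₀ * ψ x) = n₀ * α x := by
  rw [h.deriv_horizontal hφ hx, hE x hx, hψ x hx]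
  have := mul_dφ (k := k) hl (Ioo_subset_Icc_self hx) (G x) (α x)
  linear_combination n₀ * this

/-- The horizontal momentum equation for a rotated solution. -/
theorem horizontal_eq (h : K.IsSol k lam F G α β) (hl : 0 < lam) (hn : n₀ ^ 2 + n₁ ^ 2 = 1)
    (hE : ∀ x ∈ Ioo K.a K.b, E x = K.ε x)
    (hφ : ∀ x ∈ Ioo K.a K.b, φ x = n₀ * F x) (hθ : ∀ x ∈ Ioo K.a K.b, θ x = n₁ * F x)
    (hψ : ∀ x ∈ Ioo K.a K.b, ψ x = G x) {x : ℝ} (hx : x ∈ Ioo K.a K.b) :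
    -deriv (fun y => lam * E y * deriv φ y) x
      + (lam ^ 2 * K.ρ x + lam * E x * k ^ 2 + (k * n₀) ^ 2 * K.A lam x) * φ x
    = -(k * n₀) * (K.A lam x * deriv ψ x + (lam * deriv E x - K.g * K.ρ x) * ψ x)
      - (k * n₀) * (k * n₁) * K.A lam x * θ x := by
  have hx' := Ioo_subset_Icc_self hx
  have hEd : HasDerivAt K.ε (deriv K.ε x) x :=
    ((K.ε_smooth x hx').differentiableAt (by simp)).hasDerivAt
  have e1 : E =ᶠ[𝓝 x] K.ε := (eventually_of_mem (Ioo_mem_nhds hx.1 hx.2)) hE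
  have e2 : (fun y => lam * E y * deriv φ y) =ᶠ[𝓝 x]
      fun y => n₀ * α y + lam * k * n₀ * (K.ε y * G y) := by
    filter_upwards [Ioo_mem_nhds hx.1 hx.2] with y hy
    have := h.shear_eq hl hE hφ hψ hy
    rw [← this, hE y hy, hψ y hy]
    ring
  have e3 := ((h.hα x hx').const_mul n₀).add ((hEd.mul (h.hψ x hx')).const_mul (lam * k * n₀))
  rw [e2.deriv_eq]
  erw [e3.deriv]
  rw [e1.deriv_eq, h.deriv_vertical hψ hx, hφ x hx, hθ x hx, hψ x hx, hE x hx]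
  linear_combination (k ^ 2 * n₀ * K.A lam x * F x) * hn

/-- The vertical momentum equation for a rotated solution. -/
theorem vertical_eq (h : K.IsSol k lam F G α β) (hl : 0 < lam) (hn : n₀ ^ 2 + n₁ ^ 2 = 1)
    (hE : ∀ x ∈ Ioo K.a K.b, E x = K.ε x) (hA : ∀ x ∈ Ioo K.a K.b, A x = K.A lam x)
    (hN : ∀ x ∈ Ioo K.a K.b, N x = K.A lam x + lam * K.ε x)
    (hφ : ∀ x ∈ Ioo K.a K.b, φ x = n₀ * F x) (hθ : ∀ x ∈ Ioo K.a K.b, θ x = n₁ * F x)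
    (hψ : ∀ x ∈ Ioo K.a K.b, ψ x = G x) {x : ℝ} (hx : x ∈ Ioo K.a K.b) :
    -deriv (fun y => N y * deriv ψ y) x + (lam ^ 2 * K.ρ x + lam * E x * k ^ 2) * ψ x
    = deriv (fun y => A y * (k * n₀ * φ y + k * n₁ * θ y)) x
      + (K.g * K.ρ x - lam * deriv E x) * (k * n₀ * φ x + k * n₁ * θ x) := by
  have hx' := Ioo_subset_Icc_self hx
  have hEd : HasDerivAt K.ε (deriv K.ε x) x :=
    ((K.ε_smooth x hx').differentiableAt (by simp)).hasDerivAt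
  have hAd : HasDerivAt (K.A lam) (deriv (K.A lam) x) x :=
    ((contDiffAt_A hx').differentiableAt (by simp)).hasDerivAt
  have hc : ∀ y ∈ Ioo K.a K.b, k * n₀ * φ y + k * n₁ * θ y = k * F y := fun y hy => by
    rw [hφ y hy, hθ y hy]
    linear_combination (k * F y) * hn
  have e1 : E =ᶠ[𝓝 x] K.ε := (eventually_of_mem (Ioo_mem_nhds hx.1 hx.2)) hE
  have e2 : (fun y => N y * deriv ψ y) =ᶠ[𝓝 x]
      fun y => β y - k * ((K.A lam y - lam * K.ε y) * F y) := by
    filter_upwards [Ioo_mem_nhds hx.1 hx.2] with y hy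
    rw [h.deriv_vertical hψ hy, hN y hy, mul_dψ hl (Ioo_subset_Icc_self hy)]
    ring
  have e3 : (fun y => A y * (k * n₀ * φ y + k * n₁ * θ y)) =ᶠ[𝓝 x]
      fun y => k * (K.A lam y * F y) := by
    filter_upwards [Ioo_mem_nhds hx.1 hx.2] with y hy
    rw [hc y hy, hA y hy]
    ring
  have d2 := (h.hβ x hx').sub
    (((hAd.sub (hEd.const_mul lam)).mul (h.hφ x hx')).const_mul k)
  have d3 := (hAd.mul (h.hφ x hx')).const_mul k
  rw [e2.deriv_eq, e3.deriv_eq]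
  erw [d2.deriv, d3.deriv]
  rw [e1.deriv_eq, hc x hx, hψ x hx, hE x hx]
  have := mul_dφ (k := k) hl hx' (G x) (α x)
  simp only [Pi.sub_apply]
  linear_combination (-k) * this

end IsSol

end Layer

/-! ### Gluing the layers into a normal mode -/

/-- The function equal to `f` on the negative and to `g` on the nonnegative half line. -/
def glue (f g : ℝ → ℝ) (x : ℝ) : ℝ := if x < 0 then f x else g x

theorem glue_of_neg {f g : ℝ → ℝ} {x : ℝ} (hx : x < 0) : glue f g x = f x := if_pos hx

theorem glue_of_nonneg {f g : ℝ → ℝ} {x : ℝ} (hx : 0 ≤ x) : glue f g x = g x := if_neg hx.not_gt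

theorem continuousOn_glue {f g : ℝ → ℝ} {a b : ℝ} (ha : a < 0) (hb : 0 < b)
    (hf : ContinuousOn f (Icc a 0)) (hg : ContinuousOn g (Icc 0 b)) (h0 : g 0 = f 0) :
    ContinuousOn (glue f g) (Icc a b) := by
  rw [← Icc_union_Icc_eq_Icc ha.le hb.le]
  refine ContinuousOn.union_of_isClosed (hf.congr fun x hx => ?_)
    (hg.congr fun x hx => glue_of_nonneg hx.1) isClosed_Icc isClosed_Icc
  rcases hx.2.lt_or_eq with h | rfl
  · exact glue_of_neg h
  · rw [glue_of_nonneg le_rfl, h0]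

theorem hasJump_of_eqOn {f f₁ f₂ : ℝ → ℝ} {a b J : ℝ} (ha : a < 0) (hb : 0 < b)
    (h₁ : ∀ x ∈ Ioo a 0, f x = f₁ x) (h₂ : ∀ x ∈ Ioo 0 b, f x = f₂ x)
    (c₁ : ContinuousAt f₁ 0) (c₂ : ContinuousAt f₂ 0) (hJ : f₂ 0 - f₁ 0 = J) : HasJump f J := by
  refine ⟨f₁ 0, f₂ 0, ?_, ?_, hJ⟩
  · refine (c₁.tendsto.mono_left nhdsWithin_le_nhds).congr' ?_
    filter_upwards [Ioo_mem_nhdsLT ha] with x hx using (h₁ x hx).symm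
  · refine (c₂.tendsto.mono_left nhdsWithin_le_nhds).congr' ?_
    filter_upwards [Ioo_mem_nhdsGT hb] with x hx using (h₂ x hx).symm

namespace RTParams

variable {D : RTParams} {k lam n₀ n₁ : ℝ} {y₁ y₂ : ℝ → Fin 4 → ℝ}

theorem smoothOnLayers_glue {f g : ℝ → ℝ} (n : ℝ) (hf : ContDiffOn ℝ ∞ f (Ioo (-D.m) 0))
    (hg : ContDiffOn ℝ ∞ g (Ioo 0 D.ell)) : D.SmoothOnLayers (fun x => n * glue f g x) :=
  ⟨(contDiffOn_const.mul hf).congr fun x hx => by rw [glue_of_neg hx.2],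
    (contDiffOn_const.mul hg).congr fun x hx => by rw [glue_of_nonneg hx.1.le]⟩

theorem isNormalMode_of_isMatched {ξ : EuclideanSpace ℝ (Fin 2)} (hl : 0 < lam)
    (hk : ‖ξ‖ = k) (hn : n₀ ^ 2 + n₁ ^ 2 = 1) (hξ₀ : ξ 0 = k * n₀) (hξ₁ : ξ 1 = k * n₁)
    (h : Layer.IsMatched D.lower D.upper k (D.σ * k ^ 2) lam 0 y₁ y₂) :
    D.IsNormalMode ξ lam (fun x => n₀ * glue (fun x => y₁ x 0) (fun x => y₂ x 0) x)
      (fun x => n₁ * glue (fun x => y₁ x 0) (fun x => y₂ x 0) x)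
      (glue (fun x => y₁ x 1) (fun x => y₂ x 1)) := by
  have hm : -D.m < 0 := neg_lt_zero.2 D.m_pos
  have hell := D.ell_pos
  have z₁ : (0 : ℝ) ∈ Icc D.lower.a D.lower.b := right_mem_Icc.2 D.lower.a_lt_b.le
  have z₂ : (0 : ℝ) ∈ Icc D.upper.a D.upper.b := left_mem_Icc.2 D.upper.a_lt_b.le
  obtain ⟨s₁, s₂, ⟨w1, w2⟩, ⟨w3, w4⟩, j0, j1, j2, j3⟩ := h
  replace w1 : y₁ (-D.m) 0 = 0 := w1
  replace w2 : y₁ (-D.m) 1 = 0 := w2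
  replace w3 : y₂ D.ell 0 = 0 := w3
  replace w4 : y₂ D.ell 1 = 0 := w4
  replace j0 : y₂ 0 0 = y₁ 0 0 := j0
  replace j1 : y₂ 0 1 = y₁ 0 1 := j1
  replace j2 : y₂ 0 2 = y₁ 0 2 := j2
  replace j3 : y₂ 0 3 = y₁ 0 3 + D.σ * k ^ 2 * y₁ 0 1 + 0 := j3
  have cF := continuousOn_glue hm hell (fun x hx => (s₁.hφ x hx).continuousAt.continuousWithinAt)
    (fun x hx => (s₂.hφ x hx).continuousAt.continuousWithinAt) j0
  have cG := continuousOn_glue hm hell (fun x hx => (s₁.hψ x hx).continuousAt.continuousWithinAt)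
    (fun x hx => (s₂.hψ x hx).continuousAt.continuousWithinAt) j1
  set F := glue (fun x => y₁ x 0) (fun x => y₂ x 0) with hF
  set G := glue (fun x => y₁ x 1) (fun x => y₂ x 1) with hG
  have F₁ : ∀ n : ℝ, ∀ x ∈ Ioo (-D.m) 0, n * F x = n * y₁ x 0 := fun n x hx => by
    rw [hF, glue_of_neg hx.2]
  have F₂ : ∀ n : ℝ, ∀ x ∈ Ioo 0 D.ell, n * F x = n * y₂ x 0 := fun n x hx => by
    rw [hF, glue_of_nonneg hx.1.le]
  have G₁ : ∀ x ∈ Ioo (-D.m) 0, G x = y₁ x 1 := fun x hx => glue_of_neg hx.2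
  have G₂ : ∀ x ∈ Ioo 0 D.ell, G x = y₂ x 1 := fun x hx => glue_of_nonneg hx.1.le
  have E₁ : ∀ x ∈ Ioo (-D.m) 0, D.eps0 x = D.lower.ε x := fun x hx => D.eps0_of_neg hx.2
  have E₂ : ∀ x ∈ Ioo 0 D.ell, D.eps0 x = D.upper.ε x := fun x hx => D.eps0_of_nonneg hx.1.le
  have A₁ : ∀ x ∈ Ioo (-D.m) 0, D.coefA lam x = D.lower.A lam x :=
    fun x hx => D.coefA_of_neg lam hx.2
  have A₂ : ∀ x ∈ Ioo 0 D.ell, D.coefA lam x = D.upper.A lam x :=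
    fun x hx => D.coefA_of_nonneg lam hx.1.le
  have N₁ : ∀ x ∈ Ioo (-D.m) 0, 4 * lam * D.eps0 x / 3 + lam * D.del0 x + D.pr0 x =
      D.lower.A lam x + lam * D.lower.ε x := fun x hx => by
    rw [← A₁ x hx, ← E₁ x hx, coefA]; ring
  have N₂ : ∀ x ∈ Ioo 0 D.ell, 4 * lam * D.eps0 x / 3 + lam * D.del0 x + D.pr0 x =
      D.upper.A lam x + lam * D.upper.ε x := fun x hx => by
    rw [← A₂ x hx, ← E₂ x hx, coefA]; ring
  have hn' : n₁ ^ 2 + n₀ ^ 2 = 1 := by linarith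
  have hcomb : ∀ f : ℝ, k * n₀ * (n₀ * f) + k * n₁ * (n₁ * f) = k * f := fun f => by
    linear_combination (k * f) * hn
  have cε₁ := (D.lower.ε_smooth 0 z₁).continuousAt
  have cε₂ := (D.upper.ε_smooth 0 z₂).continuousAt
  have cA₁ := (Layer.contDiffAt_A (lam := lam) z₁).continuousAt
  have cA₂ := (Layer.contDiffAt_A (lam := lam) z₂).continuousAt
  have c10 := (s₁.hφ 0 z₁).continuousAt
  have c11 := (s₁.hψ 0 z₁).continuousAt
  have c12 := (s₁.hα 0 z₁).continuousAt
  have c13 := (s₁.hβ 0 z₁).continuousAt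
  have c20 := (s₂.hφ 0 z₂).continuousAt
  have c21 := (s₂.hψ 0 z₂).continuousAt
  have c22 := (s₂.hα 0 z₂).continuousAt
  have c23 := (s₂.hβ 0 z₂).continuousAt
  have cq₁ : ContinuousAt (fun x => D.lower.dψ k lam x (y₁ x 0) (y₁ x 3)) 0 := by
    have hne := (add_pos (Layer.A_pos hl z₁) (mul_pos hl (D.lower.ε_pos 0 z₁))).ne'
    unfold Layer.dψ
    exact ContinuousAt.div (by fun_prop) (by fun_prop) hne
  have cq₂ : ContinuousAt (fun x => D.upper.dψ k lam x (y₂ x 0) (y₂ x 3)) 0 := by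
    have hne := (add_pos (Layer.A_pos hl z₂) (mul_pos hl (D.upper.ε_pos 0 z₂))).ne'
    unfold Layer.dψ
    exact ContinuousAt.div (by fun_prop) (by fun_prop) hne
  refine ⟨continuousOn_const.mul cF, continuousOn_const.mul cF, cG, ?_, ?_, ?_, ?_, ?_, ?_,
    ?_, ?_, ?_, ?_, ?_, ?_⟩
  · rintro x (hx | hx)
    · rw [A₁ x hx, D.rho0_of_neg hx.2, hk, hξ₀, hξ₁]
      exact s₁.horizontal_eq hl hn E₁ (F₁ n₀) (F₁ n₁) G₁ hx
    · rw [A₂ x hx, D.rho0_of_nonneg hx.1.le, hk, hξ₀, hξ₁]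
      exact s₂.horizontal_eq hl hn E₂ (F₂ n₀) (F₂ n₁) G₂ hx
  -- The second equation is the first with `n₀` and `n₁` exchanged.
  · rintro x (hx | hx)
    · rw [A₁ x hx, D.rho0_of_neg hx.2, hk, hξ₀, hξ₁, mul_comm (k * n₀)]
      exact s₁.horizontal_eq hl hn' E₁ (F₁ n₁) (F₁ n₀) G₁ hx
    · rw [A₂ x hx, D.rho0_of_nonneg hx.1.le, hk, hξ₀, hξ₁, mul_comm (k * n₀)]
      exact s₂.horizontal_eq hl hn' E₂ (F₂ n₁) (F₂ n₀) G₂ hx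
  · rintro x (hx | hx)
    · rw [D.rho0_of_neg hx.2, hk, hξ₀, hξ₁]
      exact s₁.vertical_eq hl hn E₁ A₁ N₁ (F₁ n₀) (F₁ n₁) G₁ hx
    · rw [D.rho0_of_nonneg hx.1.le, hk, hξ₀, hξ₁]
      exact s₂.vertical_eq hl hn E₂ A₂ N₂ (F₂ n₀) (F₂ n₁) G₂ hx
  · exact hasJump_of_eqOn hm hell (F₁ n₀) (F₂ n₀) (by fun_prop) (by fun_prop)
      (by rw [j0, sub_self])
  · exact hasJump_of_eqOn hm hell (F₁ n₁) (F₂ n₁) (by fun_prop) (by fun_prop)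
      (by rw [j0, sub_self])
  · exact hasJump_of_eqOn hm hell G₁ G₂ c11 c21 (by rw [j1, sub_self])
  · refine hasJump_of_eqOn hm hell (f₁ := fun x => n₀ * y₁ x 2) (f₂ := fun x => n₀ * y₂ x 2)
      (fun x hx => ?_) (fun x hx => ?_) (by fun_prop) (by fun_prop) (by rw [j2, sub_self])
    · rw [hξ₀]
      exact s₁.shear_eq hl E₁ (F₁ n₀) G₁ hx
    · rw [hξ₀]
      exact s₂.shear_eq hl E₂ (F₂ n₀) G₂ hx
  · refine hasJump_of_eqOn hm hell (f₁ := fun x => n₁ * y₁ x 2) (f₂ := fun x => n₁ * y₂ x 2)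
      (fun x hx => ?_) (fun x hx => ?_) (by fun_prop) (by fun_prop) (by rw [j2, sub_self])
    · rw [hξ₁]
      exact s₁.shear_eq hl E₁ (F₁ n₁) G₁ hx
    · rw [hξ₁]
      exact s₂.shear_eq hl E₂ (F₂ n₁) G₂ hx
  · refine ⟨_, _, hasJump_of_eqOn hm hell
      (f₁ := fun x => D.lower.A lam x * (D.lower.dψ k lam x (y₁ x 0) (y₁ x 3) + k * y₁ x 0))
      (f₂ := fun x => D.upper.A lam x * (D.upper.dψ k lam x (y₂ x 0) (y₂ x 3) + k * y₂ x 0))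
      (fun x hx => ?_) (fun x hx => ?_) (by fun_prop) (by fun_prop) rfl,
      hasJump_of_eqOn hm hell
      (f₁ := fun x => lam * D.lower.ε x *
        (D.lower.dψ k lam x (y₁ x 0) (y₁ x 3) - k * y₁ x 0))
      (f₂ := fun x => lam * D.upper.ε x *
        (D.upper.dψ k lam x (y₂ x 0) (y₂ x 3) - k * y₂ x 0))
      (fun x hx => ?_) (fun x hx => ?_) (by fun_prop) (by fun_prop) rfl, ?_⟩
    · rw [s₁.deriv_vertical G₁ hx, A₁ x hx, add_assoc, hξ₀, hξ₁, hcomb, hF, glue_of_neg hx.2]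
    · rw [s₂.deriv_vertical G₂ hx, A₂ x hx, add_assoc, hξ₀, hξ₁, hcomb, hF,
        glue_of_nonneg hx.1.le]
    · rw [s₁.deriv_vertical G₁ hx, E₁ x hx, sub_sub, hξ₀, hξ₁, hcomb, hF, glue_of_neg hx.2]
    · rw [s₂.deriv_vertical G₂ hx, E₂ x hx, sub_sub, hξ₀, hξ₁, hcomb, hF,
        glue_of_nonneg hx.1.le]
    -- On each side the two normal terms add up to `β`, so the sum of the jumps is the jump of `β`.
    · have m1 := Layer.mul_dψ (k := k) hl z₁ (y₁ 0 0) (y₁ 0 3)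
      have m2 := Layer.mul_dψ (k := k) hl z₂ (y₂ 0 0) (y₂ 0 3)
      have g0 : G 0 = y₁ 0 1 := by rw [hG, glue_of_nonneg le_rfl, j1]
      rw [hk, g0]
      linear_combination m2 - m1 + j3
  · constructor
    · simp only [hF, glue_of_neg hm, w1, mul_zero]
    · simp only [hF, glue_of_nonneg hell.le, w3, mul_zero]
  · constructor
    · simp only [hF, glue_of_neg hm, w1, mul_zero]
    · simp only [hF, glue_of_nonneg hell.le, w3, mul_zero]
  · constructor
    · simp only [hG, glue_of_neg hm, w2]
    · simp only [hG, glue_of_nonneg hell.le, w4]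

/-- A growth rate and matched solutions for every unstable wave number. -/
theorem exists_mode (D : RTParams) {k : ℝ} (hk : 0 < k) (hσ : D.σ * k ^ 2 < D.g * D.jumpRho) :
    ∃ lam y₁ y₂, 0 < lam ∧ Layer.IsMatched D.lower D.upper k (D.σ * k ^ 2) lam 0 y₁ y₂ ∧
      y₁ 0 1 ≠ 0 := by
  refine Layer.exists_isMatched (K₁ := D.lower) (K₂ := D.upper) hk ?_
  have h1 : D.upper.ρ D.upper.a = D.ρp := D.upper_ρ_zero
  have h2 : D.lower.ρ D.lower.b = D.ρm := D.lower_ρ_zero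
  have h3 : D.upper.g = D.g := rfl
  have h4 : D.lower.g = D.g := rfl
  rw [h1, h2, h3, h4]
  rw [jumpRho] at hσ
  linarith

end RTParams

/-! ### Rotations of the frequency and the theorem -/

theorem norm_sq_eq_add_sq (ξ : EuclideanSpace ℝ (Fin 2)) : ‖ξ‖ ^ 2 = ξ 0 ^ 2 + ξ 1 ^ 2 := by
  rw [EuclideanSpace.real_norm_sq_eq, Fin.sum_univ_two]

theorem matAct_apply (R : Matrix (Fin 2) (Fin 2) ℝ) (ξ : EuclideanSpace ℝ (Fin 2)) (i : Fin 2) :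
    matAct R ξ i = R i 0 * ξ 0 + R i 1 * ξ 1 := by
  fin_cases i <;> simp [matAct]

theorem norm_matAct {R : Matrix (Fin 2) (Fin 2) ℝ}
    (hR : R ∈ Matrix.specialOrthogonalGroup (Fin 2) ℝ) (ξ : EuclideanSpace ℝ (Fin 2)) :
    ‖matAct R ξ‖ = ‖ξ‖ := by
  have h := (Matrix.mem_orthogonalGroup_iff' _ _).1
    (Matrix.mem_specialOrthogonalGroup_iff.1 hR).1
  have h00 := congrFun (congrFun h 0) 0
  have h01 := congrFun (congrFun h 0) 1
  have h11 := congrFun (congrFun h 1) 1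
  simp [Matrix.mul_apply, Fin.sum_univ_two] at h00 h01 h11
  rw [← sq_eq_sq₀ (norm_nonneg _) (norm_nonneg _), norm_sq_eq_add_sq, norm_sq_eq_add_sq,
    matAct_apply, matAct_apply]
  linear_combination ξ 0 ^ 2 * h00 + 2 * ξ 0 * ξ 1 * h01 + ξ 1 ^ 2 * h11

end

theorem theorem1 (D : RTParams) :
    ∃ (lam : ℝ → ℝ) (φ θ ψ : EuclideanSpace ℝ (Fin 2) → ℝ → ℝ),
      (∀ ξ ∈ D.unstableFreq,
        0 < lam ‖ξ‖ ∧
        D.IsNormalMode ξ (lam ‖ξ‖) (φ ξ) (θ ξ) (ψ ξ) ∧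
        D.SmoothOnLayers (φ ξ) ∧ D.SmoothOnLayers (θ ξ) ∧ D.SmoothOnLayers (ψ ξ) ∧
        ψ ξ 0 ≠ 0) ∧
      (∀ ξ ∈ D.unstableFreq, ∀ R ∈ Matrix.specialOrthogonalGroup (Fin 2) ℝ,
        ∀ x ∈ Icc (-D.m) D.ell,
          ![φ (matAct R ξ) x, θ (matAct R ξ) x, ψ (matAct R ξ) x] =
            !![R 0 0, R 0 1, 0; R 1 0, R 1 1, 0; 0, 0, 1] *ᵥ ![φ ξ x, θ ξ x, ψ ξ x]) := by
  -- The choice is made per wave number `k`, not per `ξ`, so that everything chosen is rotation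
  -- invariant; stable `k` receive dummy values.
  have H : ∀ k : ℝ, ∃ lam y₁ y₂, 0 < k → D.σ * k ^ 2 < D.g * D.jumpRho →
      0 < lam ∧ Layer.IsMatched D.lower D.upper k (D.σ * k ^ 2) lam 0 y₁ y₂ ∧ y₁ 0 1 ≠ 0 := by
    intro k
    by_cases hk : 0 < k ∧ D.σ * k ^ 2 < D.g * D.jumpRho
    · obtain ⟨lam, y₁, y₂, h⟩ := D.exists_mode hk.1 hk.2
      exact ⟨lam, y₁, y₂, fun _ _ => h⟩
    · exact ⟨0, 0, 0, fun h1 h2 => absurd ⟨h1, h2⟩ hk⟩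
  choose lam y₁ y₂ H using H
  refine ⟨lam, fun ξ x => ξ 0 / ‖ξ‖ * glue (fun x => y₁ ‖ξ‖ x 0) (fun x => y₂ ‖ξ‖ x 0) x,
    fun ξ x => ξ 1 / ‖ξ‖ * glue (fun x => y₁ ‖ξ‖ x 0) (fun x => y₂ ‖ξ‖ x 0) x,
    fun ξ => glue (fun x => y₁ ‖ξ‖ x 1) (fun x => y₂ ‖ξ‖ x 1), fun ξ hξ => ?_,
    fun ξ _ R hR x _ => ?_⟩
  · have hk : 0 < ‖ξ‖ := (norm_nonneg ξ).lt_of_ne fun h0 => by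
      have := hξ.1
      rw [← h0] at this
      simp at this
    obtain ⟨hl, hm, h0⟩ := H ‖ξ‖ hk hξ.2
    have hn : (ξ 0 / ‖ξ‖) ^ 2 + (ξ 1 / ‖ξ‖) ^ 2 = 1 := by
      rw [div_pow, div_pow, ← add_div, ← norm_sq_eq_add_sq, div_self (by positivity)]
    obtain ⟨a0, a1, -, -⟩ := hm.sol₁.contDiffOn hl
    obtain ⟨b0, b1, -, -⟩ := hm.sol₂.contDiffOn hl
    refine ⟨hl, RTParams.isNormalMode_of_isMatched hl rfl hn (by field_simp) (by field_simp) hm,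
      RTParams.smoothOnLayers_glue _ a0 b0, RTParams.smoothOnLayers_glue _ a0 b0, ?_, ?_⟩
    · simpa using RTParams.smoothOnLayers_glue (D := D) 1 a1 b1
    · have j1 : y₂ ‖ξ‖ 0 1 = y₁ ‖ξ‖ 0 1 := hm.jump1
      simpa only [glue_of_nonneg le_rfl, j1] using h0
  -- Only the prefactors `ξ 0` and `ξ 1` change under rotation, and they transform linearly.
  · simp only [norm_matAct hR, matAct_apply]
    ext i
    fin_cases i <;>
      simp [Matrix.mulVec, dotProduct, Fin.sum_univ_three] <;> ring
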